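/- Let $M$ be a connected smooth manifold of dimension $2n+2$, $n>1$, with a Lorentz $\mathcal S$-structure $(\varphi,\xi_\alpha,\eta^\alpha,g)$, $\alpha\in\{1,2\}$, such that $\xi_1$ is timelike. That is, $g$ is a Lorentz metric, $\varphi$ is a nowhere vanishing $(1,1)$-tensor field whose kernel is spanned by the vector fields $\xi_1,\xi_2$, the $\eta^\alpha$ are 1-forms, and $$\varphi^2=-I+\sum_\alpha\eta^\alpha\otimes\xi_\alpha,\quad \eta^\alpha(\xi_\beta)=\delta^\alpha_\beta,\quad g(\varphi X,\varphi Y)=g(X,Y)-\sum_\alpha\varepsilon_\alpha\eta^\alpha(X)\eta^\alpha(Y),$$ $$N_\varphi+2\sum_\alpha d\eta^\alpha\otimes\xi_\alpha=0,\qquad d\eta^1=d\eta^2=\Phi,\quad \Phi(X,Y)=g(X,\varphi Y),$$ where $\varepsilon_\alpha=\pm1$ according to whether $\xi_\alpha$ is spacelike or timelike, $N_\varphi$ is the Nijenhuis torsion, and $2\,d\eta(X,Y)=X\eta(Y)-Y\eta(X)-\eta([X,Y])$. Let $\nabla$ be the Levi-Civita connection of $g$ and $R(X,Y)Z=\nabla_X\nabla_YZ-\nabla_Y\nabla_XZ-\nabla_{[X,Y]}Z$.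 Fix $p\in M$ (all objects below are taken at $p$). For a null vector $u\in T_pM$ let $\pi:u^\perp\to u^\perp/\mathrm{span}\{u\}$ be the projection and let the Jacobi operator $\bar R_u$ be the endomorphism of $u^\perp/\mathrm{span}\{u\}$ with $\bar R_u\pi(x)=\pi(R(x,u)u)$. Let $$N_\varphi(\xi_1)=\{\xi_1+x \mid x\in\operatorname{Im}\varphi_p,\ x\perp\xi_1,\ g(x,x)=1\}.$$ $M$ is called $\varphi$-null Osserman with respect to $\xi_1$ at $p$ if the characteristic polynomial of $\bar R_u$ does not depend on $u\in N_\varphi(\xi_1)$. The space $\operatorname{Im}\varphi_p\cap u^\perp$ is identified with its image under $\pi$. Put $\tilde\xi=\xi_1+\xi_2$, $\tilde\eta=\sum_\alpha\varepsilon_\alpha\eta^\alpha$, let $\pi^I:T_pM\to\operatorname{Im}\varphi_p$ be the projection along $\ker\varphi_p$, and, for an almost Hermitian structure $J$ on $\operatorname{Im}\varphi_p$ (a linear map with $J^2=-I$ and $g(Jx,Jy)=g(x,y)$), put $$S^*(x,y)v=\tilde\eta(y)\tilde\eta(v)x-\tilde\eta(x)\tilde\eta(v)y+g(y,v)\tilde\eta(x)\tilde\xi-g(x,v)\tilde\eta(y)\tilde\xi,$$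 $$S_*(x,y)v=-g(\varphi y,\varphi v)\varphi^2x+g(\varphi x,\varphi v)\varphi^2y,$$ $$R^0(x,y)v=g(\pi^Iy,\pi^Iv)\pi^Ix-g(\pi^Ix,\pi^Iv)\pi^Iy,$$ $$R^J(x,y)v=g(J\pi^Iy,\pi^Iv)J\pi^Ix-g(J\pi^Ix,\pi^Iv)J\pi^Iy+2g(\pi^Ix,J\pi^Iy)J\pi^Iv.$$ Then the following three statements are equivalent. (a) $M$ is $\varphi$-null Osserman with respect to $\xi_1$ at $p$, and there are real numbers $c_1\neq c_2$ such that for every $u\in N_\varphi(\xi_1)$ the restriction of $\bar R_u$ to $\operatorname{Im}\varphi_p\cap u^\perp$ has exactly the two eigenvalues $c_1$ and $c_2$, with multiplicities $1$ and $2(n-1)$, respectively. (b) There exist an almost Hermitian structure $J$ on $\operatorname{Im}\varphi_p$ and real numbers $c_1\neq c_2$ such that for all $x,y,v\in T_pM$ $$R(x,y)v=S^*(x,y)v-S_*(x,y)v+c_2R^0(x,y)v+\tfrac{c_1-c_2}{3}R^J(x,y)v.$$ (c) For all $v\in\mathrm{span}\{\xi_1\}$ and $x\in\xi_1^\perp$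 one has $R(x,v)v=(\eta^1(v))^2(x-\tilde\eta(x)\xi_2)$; and there exist an almost Hermitian structure $J$ on $\operatorname{Im}\varphi_p$ and real numbers $c_1\neq c_2$ such that for all $x,y,v\in\xi_1^\perp$ $$R(x,y)v=\eta^2(v)\big(\eta^2(y)x-\eta^2(x)y\big)+\big(g(y,v)\eta^2(x)-g(x,v)\eta^2(y)\big)\tilde\xi+g(\varphi y,\varphi v)\varphi^2x-g(\varphi x,\varphi v)\varphi^2y+c_2R^0(x,y)v+\tfrac{c_1-c_2}{3}R^J(x,y)v.$$ Moreover, for any fixed real numbers $c_1\neq c_2$, the three statements with these values of $c_1,c_2$ are equivalent. -/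

import Mathlib

open Bundle Module Polynomial
open scoped Manifold ContDiff

noncomputable section

namespace PhiNullOsserman

section General

variable {E : Type*} [NormedAddCommGroup E] [NormedSpace ℝ E]
  {H : Type*} [TopologicalSpace H] (I : ModelWithCorners ℝ E H)
  {M : Type*} [TopologicalSpace M] [ChartedSpace H M]

/-! ### Differential operators on vector fields -/

/-- The vector field `X` is differentiable at `p`. -/
def VDiffAt [IsManifold I ∞ M] (X : ∀ q : M, TangentSpace I q) (p : M) : Prop :=
  MDifferentiableAt I (I.prod 𝓘(ℝ, E))
    (fun q ↦ (TotalSpace.mk' E q (X q) : TotalSpace E (TangentSpace I : M → Type _))) p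

/-- The exterior derivative of a 1-form, in the convention
`2 dη(X, Y) = X(η(Y)) - Y(η(X)) - η([X, Y])`. -/
def extDerivOneForm (η : ∀ q : M, TangentSpace I q →L[ℝ] ℝ)
    (X Y : ∀ q : M, TangentSpace I q) (p : M) : ℝ :=
  (1 / 2 : ℝ) * (mvfderiv I (fun q ↦ η q (Y q)) p (X p) - mvfderiv I (fun q ↦ η q (X q)) p (Y p)
    - η p (VectorField.mlieBracket I X Y p))

/-- The Nijenhuis torsion
`N_φ(X, Y) = [φX, φY] - φ[φX, Y] - φ[X, φY] + φ²[X, Y]` of a (1,1)-tensor field. -/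
def nijenhuis (φ : ∀ q : M, TangentSpace I q →L[ℝ] TangentSpace I q)
    (X Y : ∀ q : M, TangentSpace I q) (p : M) : TangentSpace I p :=
  VectorField.mlieBracket I (fun q ↦ φ q (X q)) (fun q ↦ φ q (Y q)) p
    - φ p (VectorField.mlieBracket I (fun q ↦ φ q (X q)) Y p)
    - φ p (VectorField.mlieBracket I X (fun q ↦ φ q (Y q)) p)
    + φ p (φ p (VectorField.mlieBracket I X Y p))

variable (M) in
/-- A smooth Lorentz metric, i.e. a smooth field of symmetric bilinear forms of signature
`(-, +, …, +)`: at each point there is a vector `z` with `g(z, z) < 0` such that `g` is positive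
definite on the orthogonal complement of `z`. -/
structure LorentzMetric [IsManifold I ∞ M] where
  /-- the bilinear form on each tangent space -/
  form : ∀ p : M, TangentSpace I p →L[ℝ] TangentSpace I p →L[ℝ] ℝ
  symm : ∀ p x y, form p x y = form p y x
  lorentz : ∀ p, ∃ z, form p z z < 0 ∧ ∀ v, form p z v = 0 → v ≠ 0 → 0 < form p v v
  smooth : ContMDiff I (I.prod 𝓘(ℝ, E →L[ℝ] E →L[ℝ] ℝ)) ∞
    (fun p ↦ (TotalSpace.mk' (E →L[ℝ] E →L[ℝ] ℝ) p (form p) :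
      TotalSpace (E →L[ℝ] E →L[ℝ] ℝ)
        (fun q : M ↦ TangentSpace I q →L[ℝ] TangentSpace I q →L[ℝ] ℝ)))

variable (M) in
/-- A Lorentz `𝒮`-structure `(φ, ξ_α, η^α, g)` with `s` characteristic vector fields on `M`. -/
structure LorentzSStructure [IsManifold I ∞ M] (s : ℕ) where
  /-- the Lorentz metric -/
  g : LorentzMetric I M
  /-- the (1,1)-tensor field -/
  φ : ∀ p : M, TangentSpace I p →L[ℝ] TangentSpace I p
  /-- the characteristic vector fields -/
  ξ : Fin s → ∀ p : M, TangentSpace I p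
  /-- the dual 1-forms -/
  η : Fin s → ∀ p : M, TangentSpace I p →L[ℝ] ℝ
  /-- the causal signs of the characteristic vector fields -/
  ε : Fin s → ℝ
  φ_smooth : ContMDiff I (I.prod 𝓘(ℝ, E →L[ℝ] E)) ∞
    (fun p ↦ (TotalSpace.mk' (E →L[ℝ] E) p (φ p) :
      TotalSpace (E →L[ℝ] E) (fun q : M ↦ TangentSpace I q →L[ℝ] TangentSpace I q)))
  ξ_smooth : ∀ α, ContMDiff I (I.prod 𝓘(ℝ, E)) ∞
    (fun p ↦ (TotalSpace.mk' E p (ξ α p) : TotalSpace E (TangentSpace I : M → Type _)))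
  η_smooth : ∀ α, ContMDiff I (I.prod 𝓘(ℝ, E →L[ℝ] ℝ)) ∞
    (fun p ↦ (TotalSpace.mk' (E →L[ℝ] ℝ) p (η α p) :
      TotalSpace (E →L[ℝ] ℝ) (fun q : M ↦ TangentSpace I q →L[ℝ] ℝ)))
  /-- `φ` vanishes nowhere -/
  φ_ne_zero : ∀ p, φ p ≠ 0
  /-- `ker φ` is spanned by the `ξ_α` (so that `φ` has constant rank) -/
  ker_φ : ∀ p, LinearMap.ker (φ p : TangentSpace I p →ₗ[ℝ] TangentSpace I p)
    = Submodule.span ℝ (Set.range fun α ↦ ξ α p)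
  /-- `φ² = -I + η^α ⊗ ξ_α` -/
  φ_sq : ∀ p x, φ p (φ p x) = -x + ∑ α, η α p x • ξ α p
  /-- `η^α(ξ_β) = δ^α_β` -/
  η_ξ : ∀ α β p, η α p (ξ β p) = if α = β then 1 else 0
  /-- `ε_α` is `1` or `-1` according to whether `ξ_α` is spacelike or timelike -/
  causal : ∀ α, (ε α = 1 ∧ ∀ p, 0 < g.form p (ξ α p) (ξ α p)) ∨
    (ε α = -1 ∧ ∀ p, g.form p (ξ α p) (ξ α p) < 0)
  /-- `g(φX, φY) = g(X, Y) - ε_α η^α(X) η^α(Y)` -/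
  compat : ∀ p x y, g.form p (φ p x) (φ p y) = g.form p x y - ∑ α, ε α * η α p x * η α p y
  /-- normality: `N_φ + 2 dη^α ⊗ ξ_α = 0` -/
  normal : ∀ (p : M) (X Y : ∀ q : M, TangentSpace I q), VDiffAt I X p → VDiffAt I Y p →
    nijenhuis I φ X Y p + ∑ α, (2 * extDerivOneForm I (η α) X Y p) • ξ α p = 0
  /-- `dη^α = Φ`, where `Φ(X, Y) = g(X, φY)` -/
  dη_eq : ∀ (α : Fin s) (p : M) (X Y : ∀ q : M, TangentSpace I q), VDiffAt I X p → VDiffAt I Y p →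
    extDerivOneForm I (η α) X Y p = g.form p (X p) (φ p (Y p))

variable {I}

/-! ### Levi-Civita connection and curvature -/

/-- `cov` is the Levi-Civita connection of `g`: a smooth torsion-free connection on `TM` with
`X(g(Y, Z)) = g(∇_X Y, Z) + g(Y, ∇_X Z)`. (Here `∇_X Y` at `p` is `cov Y p (X p)`.)
By the fundamental theorem of semi-Riemannian geometry these properties determine `∇_X Y` for
differentiable `Y`, and such a connection always exists. -/
structure IsLeviCivita [IsManifold I ∞ M]
    [FiniteDimensional ℝ E] [CompleteSpace E] (g : LorentzMetric I M)
    (cov : CovariantDerivative I E (TangentSpace I : M → Type _)) : Prop where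
  smooth : cov.ContMDiffCovariantDerivative ∞
  torsion_free : cov.torsion = 0
  metric : ∀ (p : M) (x : TangentSpace I p) (Y Z : ∀ q : M, TangentSpace I q),
    VDiffAt I Y p → VDiffAt I Z p →
    mvfderiv I (fun q ↦ g.form q (Y q) (Z q)) p x
      = g.form p (cov Y p x) (Z p) + g.form p (Y p) (cov Z p x)

/-- `R(X, Y)Z = ∇_X ∇_Y Z - ∇_Y ∇_X Z - ∇_{[X, Y]} Z` on vector fields. -/
def curvatureField [IsManifold I ∞ M]
    (cov : CovariantDerivative I E (TangentSpace I : M → Type _))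
    (X Y Z : ∀ q : M, TangentSpace I q) (p : M) : TangentSpace I p :=
  cov (fun q ↦ cov Z q (Y q)) p (X p) - cov (fun q ↦ cov Z q (X q)) p (Y p)
    - cov Z p (VectorField.mlieBracket I X Y p)

/-- The curvature tensor `R_p(x, y)v` at a point, computed by extending the three vectors to
vector fields that are smooth near `p` (constant in the trivialization of `TM` at `p`). -/
def curvature [IsManifold I ∞ M]
    (cov : CovariantDerivative I E (TangentSpace I : M → Type _))
    (p : M) (x y v : TangentSpace I p) : TangentSpace I p :=
  curvatureField cov (FiberBundle.extend E x) (FiberBundle.extend E y) (FiberBundle.extend E v) p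

/-! ### Jacobi operators with respect to null vectors -/

namespace LorentzMetric

variable [IsManifold I ∞ M] (g : LorentzMetric I M) {p : M}

/-- The orthogonal complement `u^⊥`. -/
def perp (u : TangentSpace I p) : Submodule ℝ (TangentSpace I p) :=
  LinearMap.ker (g.form p u : TangentSpace I p →ₗ[ℝ] ℝ)

/-- The quotient `u^⊥ / span{u}` for a null vector `u` (in general
`u^⊥ / (u^⊥ ∩ span{u})`). -/
abbrev BarPerp (u : TangentSpace I p) : Type _ :=
  g.perp u ⧸ (Submodule.span ℝ {u}).submoduleOf (g.perp u)

/-- The canonical projection `π : u^⊥ → u^⊥ / span{u}`. -/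
def toBar (u : TangentSpace I p) : g.perp u →ₗ[ℝ] g.BarPerp u :=
  Submodule.mkQ _

/-- `T` is the Jacobi operator `R̄_u`, that is, the linear endomorphism of `u^⊥ / span{u}` with
`T(π(x)) = π(R(x, u)u)` for all `x ∈ u^⊥`. Since `π` is surjective, `T` is determined by `u`. -/
def IsJacobiOperator
    (cov : CovariantDerivative I E (TangentSpace I : M → Type _))
    (u : TangentSpace I p) (T : Module.End ℝ (g.BarPerp u)) : Prop :=
  ∀ x : g.perp u, ∃ h : curvature cov p x u u ∈ g.perp u,
    T (g.toBar u x) = g.toBar u ⟨curvature cov p x u u, h⟩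

/-- The celestial sphere `S(z) = {x ∈ z^⊥ | g(x, x) = 1}`. -/
def celestialSphere (z : TangentSpace I p) : Set (TangentSpace I p) :=
  {x | x ∈ g.perp z ∧ g.form p x x = 1}

end LorentzMetric

namespace LorentzSStructure

variable [IsManifold I ∞ M] {s : ℕ} (S : LorentzSStructure I M s) (p : M)

/-- `Im φ_p`. -/
def imφ : Submodule ℝ (TangentSpace I p) :=
  LinearMap.range (S.φ p : TangentSpace I p →ₗ[ℝ] TangentSpace I p)

/-- The projection `π^I = -φ² = I - η^α ⊗ ξ_α` of `T_pM = Im φ_p ⊕ ker φ_p` onto `Im φ_p`. -/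
def projIm : TangentSpace I p →ₗ[ℝ] S.imφ p :=
  -((S.φ p : TangentSpace I p →ₗ[ℝ] TangentSpace I p).rangeRestrict ∘ₗ
    (S.φ p : TangentSpace I p →ₗ[ℝ] TangentSpace I p))

/-- `ξ̃ = ∑ ξ_α`. -/
def ξtilde : TangentSpace I p := ∑ α, S.ξ α p

/-- `η̃ = ∑ ε_α η^α`. -/
def ηtilde (x : TangentSpace I p) : ℝ := ∑ α, S.ε α * S.η α p x

/-- `S^*(x, y)v`. -/
def upperS (x y v : TangentSpace I p) : TangentSpace I p :=
  (S.ηtilde p y * S.ηtilde p v) • x - (S.ηtilde p x * S.ηtilde p v) • y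
    + (S.g.form p y v * S.ηtilde p x) • S.ξtilde p - (S.g.form p x v * S.ηtilde p y) • S.ξtilde p

/-- `S_*(x, y)v`. -/
def lowerS (x y v : TangentSpace I p) : TangentSpace I p :=
  -(S.g.form p (S.φ p y) (S.φ p v) • S.φ p (S.φ p x))
    + S.g.form p (S.φ p x) (S.φ p v) • S.φ p (S.φ p y)

variable {p} in
/-- An almost Hermitian structure on `(Im φ_p, g)`: an almost complex structure preserving `g`. -/
def IsAlmostHermitian (J : Module.End ℝ (S.imφ p)) : Prop :=
  (∀ x, J (J x) = -x) ∧
    ∀ x y : S.imφ p, S.g.form p (J x : TangentSpace I p) (J y) = S.g.form p x y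

/-- `R^0(x, y)v`. -/
def R0 (x y v : TangentSpace I p) : TangentSpace I p :=
  S.g.form p (S.projIm p y) (S.projIm p v) • (S.projIm p x : TangentSpace I p)
    - S.g.form p (S.projIm p x) (S.projIm p v) • (S.projIm p y : TangentSpace I p)

variable {p} in
/-- `R^J(x, y)v`. -/
def RJ (J : Module.End ℝ (S.imφ p)) (x y v : TangentSpace I p) : TangentSpace I p :=
  S.g.form p (J (S.projIm p y)) (S.projIm p v) • (J (S.projIm p x) : TangentSpace I p)
    - S.g.form p (J (S.projIm p x)) (S.projIm p v) • (J (S.projIm p y) : TangentSpace I p)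
    + (2 * S.g.form p (S.projIm p x) (J (S.projIm p y))) • (J (S.projIm p v) : TangentSpace I p)

/-- The `φ`-celestial sphere `S_φ((ξ_α)_p) = S((ξ_α)_p) ∩ Im φ_p`. -/
def celestialSphereφ (α : Fin s) : Set (TangentSpace I p) :=
  S.g.celestialSphere (S.ξ α p) ∩ S.imφ p

/-- The `φ`-null congruence set `N_φ((ξ_α)_p)`. -/
def nullCongruenceφ (α : Fin s) : Set (TangentSpace I p) :=
  {u | ∃ x ∈ S.celestialSphereφ p α, u = S.ξ α p + x}

/-- The subspace of `u^⊥ / span{u}` represented by `Im φ_p ∩ u^⊥`. -/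
def barIm {p : M} (u : TangentSpace I p) : Submodule ℝ (S.g.BarPerp u) :=
  ((S.imφ p).submoduleOf (S.g.perp u)).map (S.g.toBar u)

variable [FiniteDimensional ℝ E]
  (cov : CovariantDerivative I E (TangentSpace I : M → Type _))

/-- `M` is `φ`-null Osserman with respect to `(ξ_α)_p` at `p`: the characteristic polynomial of
`R̄_u` is the same for all `u ∈ N_φ((ξ_α)_p)`. -/
def IsφNullOssermanAt (α : Fin s) : Prop :=
  haveI : FiniteDimensional ℝ (TangentSpace I p) := inferInstanceAs (FiniteDimensional ℝ E)
  ∃ P : ℝ[X], ∀ u ∈ S.nullCongruenceφ p α,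
    ∃ T : Module.End ℝ (S.g.BarPerp u), S.g.IsJacobiOperator cov u T ∧ LinearMap.charpoly T = P

variable {p} in
/-- The restriction of `R̄_u` to `Im φ ∩ u^⊥` has exactly the two eigenvalues `c₁` and `c₂`, of
multiplicities `m₁` and `m₂`. -/
def JacobiHasEigenvalues (u : TangentSpace I p) (c₁ c₂ : ℝ) (m₁ m₂ : ℕ) : Prop :=
  ∃ T : Module.End ℝ (S.g.BarPerp u), S.g.IsJacobiOperator cov u T ∧
    ∃ h : ∀ w ∈ S.barIm u, T w ∈ S.barIm u,
      (∀ c : ℝ, Module.End.HasEigenvalue (T.restrict h) c ↔ c = c₁ ∨ c = c₂) ∧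
      finrank ℝ (Module.End.eigenspace (T.restrict h) c₁) = m₁ ∧
      finrank ℝ (Module.End.eigenspace (T.restrict h) c₂) = m₂

end LorentzSStructure

/-! ### The three conditions, for two characteristic vector fields

The fields `ξ_1, ξ_2` and the forms `η^1, η^2` are indexed by `0, 1 : Fin 2`. -/

namespace LorentzSStructure

variable [IsManifold I ∞ M] (S : LorentzSStructure I M 2)
  (cov : CovariantDerivative I E (TangentSpace I : M → Type _)) (p : M)

/-- `M` is `φ`-null Osserman with respect to `ξ_1` at `p` and, for every `u ∈ N_φ(ξ_1)`, the
restriction of `R̄_u` to `Im φ ∩ u^⊥` has exactly the two eigenvalues `c₁`, `c₂`, of multiplicities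
`1` and `2(n - 1)`. -/
def ConditionA [FiniteDimensional ℝ E] (n : ℕ) (c₁ c₂ : ℝ) : Prop :=
  S.IsφNullOssermanAt p cov 0 ∧
    ∀ u ∈ S.nullCongruenceφ p 0, S.JacobiHasEigenvalues cov u c₁ c₂ 1 (2 * (n - 1))

variable {p} in
/-- `R = S^* - S_* + c₂ R^0 + ((c₁ - c₂)/3) R^J` on `T_pM`. -/
def ConditionB (J : Module.End ℝ (S.imφ p)) (c₁ c₂ : ℝ) : Prop :=
  ∀ x y v : TangentSpace I p, curvature cov p x y v =
    S.upperS p x y v - S.lowerS p x y v + c₂ • S.R0 p x y v + ((c₁ - c₂) / 3) • S.RJ J x y v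

/-- `R(x, v)v = (η^1(v))² (x - η̃(x) ξ_2)` for `v ∈ span{ξ_1}` and `x ∈ ξ_1^⊥`. -/
def ConditionC₁ : Prop :=
  ∀ v ∈ Submodule.span ℝ {S.ξ 0 p}, ∀ x ∈ S.g.perp (S.ξ 0 p),
    curvature cov p x v v = (S.η 0 p v) ^ 2 • (x - S.ηtilde p x • S.ξ 1 p)

variable {p} in
/-- The formula for `R` on `ξ_1^⊥`. -/
def ConditionC₂ (J : Module.End ℝ (S.imφ p)) (c₁ c₂ : ℝ) : Prop :=
  ∀ x ∈ S.g.perp (S.ξ 0 p), ∀ y ∈ S.g.perp (S.ξ 0 p), ∀ v ∈ S.g.perp (S.ξ 0 p),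
    curvature cov p x y v =
      S.η 1 p v • (S.η 1 p y • x - S.η 1 p x • y)
      + (S.g.form p y v * S.η 1 p x - S.g.form p x v * S.η 1 p y) • S.ξtilde p
      + S.g.form p (S.φ p y) (S.φ p v) • S.φ p (S.φ p x)
      - S.g.form p (S.φ p x) (S.φ p v) • S.φ p (S.φ p y)
      + c₂ • S.R0 p x y v + ((c₁ - c₂) / 3) • S.RJ J x y v

end LorentzSStructure

end General

end PhiNullOsserman

end

open PhiNullOsserman

/-! The two tensor fields of the structure are parallel up to explicit terms, so everything in the
curvature that involves `ξ_α` is forced, and what is left is a curvature tensor on the Euclidean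
space `Im φ_p`.

As in Sasakian geometry, `dη^α = Φ` and normality give `∇_x ξ_α = -ε_α φ x` (`cov_ξ`). The analogue
of "integrable and closed implies `∇J = 0`" gives `(∇_x φ) y = g(φx, φy) ξ̃ + η̃(y) φ² x`
(`covφ_eq`). Differentiating once more determines `R(x, y) ξ_α`, with the same value as `S^*(x, y)
ξ_α`. Hence `R = S^* + F` with an algebraic curvature tensor `F` on `Im φ_p`, pulled back by `π^I`
(`exists_curvature_eq`). Since `ξ_1` is timelike, `g` is positive definite on `Im φ_p`. Since `S_* =
R^0`, both (b) and (c) say exactly that `F = (c₂ - 1) R^0 + ((c₁ - c₂)/3) R^J`; the first clause of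
(c) always holds.

For `u = ξ_1 + x`, the restriction of `R̄_u` to `Im φ_p ∩ u^⊥`, which is `x^⊥` in `Im φ_p`, is `y ↦
y + F(y, x)x`. So (a) says that each `F(·, x)x` with `x` a unit vector has on `x^⊥` the simple
eigenvalue `c₁ - 1` and otherwise only `c₂ - 1`. After subtracting the constant curvature part and
rescaling, the Jacobi operators become `w(x) ⊗ w(x)` with `w(x) ⊥ x` and `|w(x)| = |x|`, where
`w(x)` is determined only up to sign. The core is `exists_complex_structure_of_jacobi`: signs can be
chosen so that `w` is a linear map `J`, which is then an almost Hermitian structure, and sectional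
curvatures determine the tensor.

Conversely, for such an `F` the operator `R̄_u` is `c₂` plus a rank two operator with eigenvectors
`Jx` and `ξ_2`. Its characteristic polynomial is `(X - c₂)^(2(n-1)) (X - c₁)(X - 1)`, which does not
involve `u`. -/

open scoped Topology

noncomputable section

namespace PhiNullOsserman

section Fields

variable {E : Type*} [NormedAddCommGroup E] [NormedSpace ℝ E]
  {H : Type*} [TopologicalSpace H] {I : ModelWithCorners ℝ E H}
  {M : Type*} [TopologicalSpace M] [ChartedSpace H M] [IsManifold I ∞ M]

/-! ### Vector fields and functions that are smooth near a point -/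

/-- The vector field `X` is smooth in a neighbourhood of `p`. -/
def SmoothNear (X : ∀ q : M, TangentSpace I q) (p : M) : Prop :=
  ∀ᶠ q in 𝓝 p, ContMDiffAt I (I.prod 𝓘(ℝ, E)) ∞
    (fun q ↦ (TotalSpace.mk' E q (X q) : TotalSpace E (TangentSpace I : M → Type _))) q

variable {p : M} {X Y Z W : ∀ q : M, TangentSpace I q}

lemma SmoothNear.contMDiffAt (hX : SmoothNear X p) : ContMDiffAt I (I.prod 𝓘(ℝ, E)) ∞
    (fun q ↦ (TotalSpace.mk' E q (X q) : TotalSpace E (TangentSpace I : M → Type _))) p :=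
  Filter.Eventually.self_of_nhds hX

lemma SmoothNear.eventually (hX : SmoothNear X p) : ∀ᶠ q in 𝓝 p, SmoothNear X q :=
  eventually_eventually_nhds.2 hX

lemma SmoothNear.vDiffAt (hX : SmoothNear X p) : VDiffAt I X p :=
  hX.contMDiffAt.mdifferentiableAt (by simp)

lemma SmoothNear.of_contMDiff (hX : ContMDiff I (I.prod 𝓘(ℝ, E)) ∞
    (fun q ↦ (TotalSpace.mk' E q (X q) : TotalSpace E (TangentSpace I : M → Type _)))) :
    SmoothNear X p :=
  Filter.Eventually.of_forall fun q ↦ hX q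

lemma SmoothNear.congr (hX : SmoothNear X p) (h : ∀ᶠ q in 𝓝 p, Y q = X q) : SmoothNear Y p := by
  filter_upwards [hX, eventually_eventually_nhds.2 h] with q hq hq'
  refine hq.congr_of_eventuallyEq ?_
  filter_upwards [hq'] with r hr
  rw [hr]

variable (I) in
lemma smoothNear_extend (v : TangentSpace I p) : SmoothNear (FiberBundle.extend E v) p := by
  obtain ⟨s, hs, h⟩ := FiberBundle.exists_contMDiffOn_extend (k := ∞) I E v
  filter_upwards [eventually_mem_nhds_iff.2 hs] with q hq
  exact h.contMDiffAt hq

lemma SmoothNear.sub (hX : SmoothNear X p) (hY : SmoothNear Y p) : SmoothNear (X - Y) p := by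
  filter_upwards [hX, hY] with q hq hq'
  exact hq.sub_section hq'

lemma SmoothNear.smul {f : M → ℝ} (hf : ∀ᶠ q in 𝓝 p, ContMDiffAt I 𝓘(ℝ, ℝ) ∞ f q)
    (hX : SmoothNear X p) : SmoothNear (f • X) p := by
  filter_upwards [hf, hX] with q hq hq'
  exact hq.smul_section hq'

lemma SmoothNear.endo {φ : ∀ q : M, TangentSpace I q →L[ℝ] TangentSpace I q}
    (hφ : ContMDiff I (I.prod 𝓘(ℝ, E →L[ℝ] E)) ∞
    (fun p ↦ (TotalSpace.mk' (E →L[ℝ] E) p (φ p) :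
      TotalSpace (E →L[ℝ] E) (fun q : M ↦ TangentSpace I q →L[ℝ] TangentSpace I q))))
    (hX : SmoothNear X p) : SmoothNear (fun q ↦ φ q (X q)) p := by
  filter_upwards [hX] with q hq
  exact (hφ q).clm_bundle_apply hq

lemma SmoothNear.oneForm {η : ∀ q : M, TangentSpace I q →L[ℝ] ℝ}
    (hη : ContMDiff I (I.prod 𝓘(ℝ, E →L[ℝ] ℝ)) ∞
    (fun p ↦ (TotalSpace.mk' (E →L[ℝ] ℝ) p (η p) :
      TotalSpace (E →L[ℝ] ℝ) (fun q : M ↦ TangentSpace I q →L[ℝ] ℝ))))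
    (hX : SmoothNear X p) : ∀ᶠ q in 𝓝 p, ContMDiffAt I 𝓘(ℝ, ℝ) ∞ (fun q ↦ η q (X q)) q := by
  filter_upwards [hX] with q hq
  have := ContMDiffAt.clm_bundle_apply (E₂ := fun _ : M ↦ ℝ) (hη q) hq
  rw [contMDiffAt_totalSpace] at this
  exact this.2

lemma SmoothNear.form (g : LorentzMetric I M) (hX : SmoothNear X p) (hY : SmoothNear Y p) :
    ∀ᶠ q in 𝓝 p, ContMDiffAt I 𝓘(ℝ, ℝ) ∞ (fun q ↦ g.form q (X q) (Y q)) q := by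
  filter_upwards [hX, hY] with q hq hq'
  have := ContMDiffAt.clm_bundle_apply₂ (E₃ := fun _ : M ↦ ℝ) (g.smooth q) hq hq'
  rw [contMDiffAt_totalSpace] at this
  exact this.2

/-- Smoothness of the connection concerns globally smooth sections. Multiplying `Y` by a bump
function makes it global, and since `∇` is local this changes nothing near `p`. -/
lemma SmoothNear.cov [FiniteDimensional ℝ E] [T2Space M]
    {cov : CovariantDerivative I E (TangentSpace I : M → Type _)}
    (hcov : cov.ContMDiffCovariantDerivative ∞) (hX : SmoothNear X p) (hY : SmoothNear Y p) :
    SmoothNear (fun q ↦ cov Y q (X q)) p := by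
  obtain ⟨U, hU, hUo, hpU⟩ := eventually_nhds_iff.1 hY
  obtain ⟨f, -, hf⟩ := (SmoothBumpFunction.nhds_basis_tsupport (I := I) p).mem_iff.1
    (hUo.mem_nhds hpU)
  have hfY : ContMDiff I (I.prod 𝓘(ℝ, E)) ∞ (fun q ↦ (TotalSpace.mk' E q (((f : M → ℝ) • Y) q) :
      TotalSpace E (TangentSpace I : M → Type _))) :=
    ContMDiffOn.smul_section_of_tsupport f.contMDiff.contMDiffOn hUo hf
      fun q hq ↦ (hU q hq).contMDiffWithinAt
  have h1 := hcov.contMDiff.contMDiff (σ := (f : M → ℝ) • Y) (contMDiffOn_univ.2 hfY)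
  have h2 : SmoothNear (fun q ↦ cov ((f : M → ℝ) • Y) q (X q)) p := by
    filter_upwards [hX] with q hq
    exact (h1.contMDiffAt Filter.univ_mem).clm_bundle_apply hq
  refine h2.congr ?_
  filter_upwards [eventually_eventually_nhds.2 f.eventuallyEq_one, hUo.mem_nhds hpU] with q hq hqU
  have := cov.isCovariantDerivativeOnUniv.congr_of_eventuallyEq (σ := Y) (σ' := (f : M → ℝ) • Y)
    (x := q) ((hU q hqU).mdifferentiableAt (by simp)) ((hfY q).mdifferentiableAt (by simp))
    Filter.univ_mem (by filter_upwards [hq] with r hr; simp [hr])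
  rw [this]

lemma SmoothNear.mlieBracket [CompleteSpace E] (hX : SmoothNear X p) (hY : SmoothNear Y p) :
    SmoothNear (VectorField.mlieBracket I X Y) p := by
  have : IsManifold I (minSmoothness ℝ 2) M := .of_le (n := ∞) (by
    rw [minSmoothness_of_isRCLikeNormedField]; exact WithTop.coe_le_coe.2 le_top)
  have : IsManifold I (((⊤ : ℕ∞) : WithTop ℕ∞) + 1) M := ‹IsManifold I ∞ M›
  filter_upwards [hX, hY] with q hq hq'
  exact ContMDiffAt.mlieBracket_vectorField (m := ⊤) (n := ⊤) hq hq' (by simp)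

lemma leibniz_mlieBracket [CompleteSpace E] (hX : SmoothNear X p) (hY : SmoothNear Y p)
    (hZ : SmoothNear Z p) :
    VectorField.mlieBracket I X (VectorField.mlieBracket I Y Z) p =
      VectorField.mlieBracket I (VectorField.mlieBracket I X Y) Z p
        + VectorField.mlieBracket I Y (VectorField.mlieBracket I X Z) p := by
  have h2 : minSmoothness ℝ 2 ≤ (∞ : WithTop ℕ∞) := by
    rw [minSmoothness_of_isRCLikeNormedField]; exact WithTop.coe_le_coe.2 le_top
  have h3 : minSmoothness ℝ 3 ≤ (∞ : WithTop ℕ∞) := by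
    rw [minSmoothness_of_isRCLikeNormedField]; exact WithTop.coe_le_coe.2 le_top
  have : IsManifold I (minSmoothness ℝ 3) M := .of_le h3
  exact VectorField.leibniz_identity_mlieBracket_apply (hX.contMDiffAt.of_le h2)
    (hY.contMDiffAt.of_le h2) (hZ.contMDiffAt.of_le h2)

/-- A bracket of vector fields acts on functions as the commutator of derivations. -/
lemma mvfderiv_mlieBracket [CompleteSpace E] [Nontrivial E] (hX : SmoothNear X p)
    (hY : SmoothNear Y p)
    {f : M → ℝ} (hf : ∀ᶠ q in 𝓝 p, ContMDiffAt I 𝓘(ℝ, ℝ) ∞ f q)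
    (hXf : MDifferentiableAt I 𝓘(ℝ, ℝ) (fun q ↦ mvfderiv I f q (X q)) p)
    (hYf : MDifferentiableAt I 𝓘(ℝ, ℝ) (fun q ↦ mvfderiv I f q (Y q)) p) :
    mvfderiv I f p (VectorField.mlieBracket I X Y p) =
      mvfderiv I (fun q ↦ mvfderiv I f q (Y q)) p (X p)
        - mvfderiv I (fun q ↦ mvfderiv I f q (X q)) p (Y p) := by
  -- The Jacobi identity is applied to `f W` and compared with `f` times the one for `W`. All terms
  -- cancel except a multiple of `W p`, whose coefficient is the defect of the claimed identity;
  -- hence `W p ≠ 0` is needed.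
  obtain ⟨w, hw⟩ : ∃ w : TangentSpace I p, w ≠ 0 := exists_ne (α := E) 0
  set W : ∀ q : M, TangentSpace I q := FiberBundle.extend E w with hWdef
  have hW : SmoothNear W p := smoothNear_extend I w
  have hWp : W p = w := FiberBundle.extend_apply_self ..
  have jac := fun (U : ∀ q : M, TangentSpace I q) (hU : SmoothNear U p) ↦
    leibniz_mlieBracket hX hY hU
  have hfd : MDifferentiableAt I 𝓘(ℝ, ℝ) f p := hf.self_of_nhds.mdifferentiableAt (by simp)
  have expand : ∀ V : (∀ q : M, TangentSpace I q),
      ∀ᶠ q in 𝓝 p, VectorField.mlieBracket I V (f • W) q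
        = ((fun q ↦ mvfderiv I f q (V q)) • W + f • VectorField.mlieBracket I V W) q := by
    intro V
    filter_upwards [hf, hW] with q hq hq'
    exact VectorField.mlieBracket_smul_right (hq.mdifferentiableAt (by simp))
      (hq'.mdifferentiableAt (by simp))
  have second : ∀ U V : (∀ q : M, TangentSpace I q), SmoothNear V p →
      MDifferentiableAt I 𝓘(ℝ, ℝ) (fun q ↦ mvfderiv I f q (V q)) p →
      VectorField.mlieBracket I U (VectorField.mlieBracket I V (f • W)) p
        = mvfderiv I (fun q ↦ mvfderiv I f q (V q)) p (U p) • w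
          + mvfderiv I f p (V p) • VectorField.mlieBracket I U W p
          + (mvfderiv I f p (U p) • VectorField.mlieBracket I V W p
          + f p • VectorField.mlieBracket I U (VectorField.mlieBracket I V W) p) := by
    intro U V hV hVf
    have hVW : VDiffAt I (VectorField.mlieBracket I V W) p :=
      (hV.mlieBracket hW).vDiffAt
    rw [Filter.EventuallyEq.mlieBracket_vectorField_eq (V₁ := U) (V := U)
        (Filter.Eventually.of_forall fun _ ↦ rfl) (expand V),
      VectorField.mlieBracket_add_right (hVf.smul_section hW.vDiffAt)
        (hfd.smul_section hVW),
      VectorField.mlieBracket_smul_right hVf hW.vDiffAt,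
      VectorField.mlieBracket_smul_right hfd hVW, hWp]
  have h1 := jac _ (hW.smul hf)
  have h2 := jac W hW
  rw [second X Y hY hYf, second Y X hX hXf,
    VectorField.mlieBracket_smul_right hfd hW.vDiffAt, h2, hWp] at h1
  have h3 : (mvfderiv I f p (VectorField.mlieBracket I X Y p) -
      (mvfderiv I (fun q ↦ mvfderiv I f q (Y q)) p (X p)
        - mvfderiv I (fun q ↦ mvfderiv I f q (X q)) p (Y p))) • w = 0 := by
    rw [← sub_eq_zero] at h1
    rw [← neg_eq_zero, ← h1]
    module
  exact sub_eq_zero.1 ((smul_eq_zero.1 h3).resolve_right hw)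

end Fields

end PhiNullOsserman

end

/-! ### Symmetries and tensoriality of the curvature -/

noncomputable section

namespace PhiNullOsserman

/-- A function of four variables with the symmetries of a curvature tensor is symmetric under
exchange of the two pairs. -/
lemma curvature_pair_symm {α : Type*} (T : α → α → α → α → ℝ)
    (h₁ : ∀ x y z w, T x y z w = -T y x z w) (h₂ : ∀ x y z w, T x y z w = -T x y w z)
    (h₃ : ∀ x y z w, T x y z w + T y z x w + T z x y w = 0) (x y z w : α) :
    T x y z w = T z w x y := by
  -- The octahedron argument: the Bianchi identities of the four cyclic shifts of `(x, y, z, w)`. No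
  -- linearity of `T` is involved, so this applies to vector fields before tensoriality is known.
  linarith [h₃ x y z w, h₃ y z w x, h₃ z w x y, h₃ w x y z, h₁ x y z w, h₁ x y w z, h₁ y z x w,
    h₁ y z w x, h₁ z x y w, h₁ z x w y, h₁ z w x y, h₁ z w y x, h₁ w x y z, h₁ w x z y,
    h₁ w y x z, h₁ w y z x, h₂ x y z w, h₂ y z x w, h₂ z x y w, h₂ z w x y, h₂ w x y z, h₂ y w x z,
    h₂ w y x z, h₂ x z y w, h₂ x w y z, h₁ x w y z, h₁ x z y w, h₁ x z w y]

lemma mvfderiv_congr {E : Type*} [NormedAddCommGroup E] [NormedSpace ℝ E]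
    {H : Type*} [TopologicalSpace H] {I : ModelWithCorners ℝ E H}
    {M : Type*} [TopologicalSpace M] [ChartedSpace H M] {p : M} {f f' : M → ℝ}
    (h : f =ᶠ[𝓝 p] f') (v : TangentSpace I p) :
    mvfderiv I f p v = mvfderiv I f' p v := by
  have := congr($(h.mfderiv_eq (I := I) (I' := 𝓘(ℝ, ℝ))) v)
  exact this

section Curvature

variable {E : Type*} [NormedAddCommGroup E] [NormedSpace ℝ E]
  {H : Type*} [TopologicalSpace H] {I : ModelWithCorners ℝ E H}
  {M : Type*} [TopologicalSpace M] [ChartedSpace H M] [IsManifold I ∞ M]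
  {g : LorentzMetric I M} {cov : CovariantDerivative I E (TangentSpace I : M → Type _)}
  {p : M} {X Y Z W : ∀ q : M, TangentSpace I q}

/-- A vector orthogonal to everything is orthogonal to the timelike `z`, and there the metric is
definite. -/
lemma LorentzMetric.eq_zero_of_forall (g : LorentzMetric I M) {v : TangentSpace I p}
    (h : ∀ w, g.form p v w = 0) : v = 0 := by
  obtain ⟨z, -, hz⟩ := g.lorentz p
  by_contra hv
  have := hz v (by rw [g.symm, h]) hv
  rw [h] at this
  exact this.false

lemma LorentzMetric.ext_form (g : LorentzMetric I M) {v v' : TangentSpace I p}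
    (h : ∀ w, g.form p v w = g.form p v' w) : v = v' :=
  sub_eq_zero.1 <| g.eq_zero_of_forall fun w ↦ by
    rw [map_sub, sub_apply, h, sub_self]

lemma cov_add (hX : VDiffAt I X p) (hY : VDiffAt I Y p) :
    cov (X + Y) p = cov X p + cov Y p :=
  cov.isCovariantDerivativeOnUniv.add hX hY

lemma cov_const_smul (c : ℝ) (hX : VDiffAt I X p) : cov (c • X) p = c • cov X p :=
  cov.isCovariantDerivativeOnUniv.smul_const c hX

lemma cov_sub (hX : VDiffAt I X p) (hY : VDiffAt I Y p) :
    cov (X - Y) p = cov X p - cov Y p := by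
  have hY' : VDiffAt I ((-1 : ℝ) • Y) p := by
    exact (mdifferentiableAt_const (c := (-1 : ℝ))).smul_section hY
  have : X - Y = X + (-1 : ℝ) • Y := by simp [sub_eq_add_neg]
  rw [this, cov_add hX hY', cov_const_smul _ hY]
  simp [sub_eq_add_neg]

lemma cov_congr (hX : VDiffAt I X p) (hY : VDiffAt I Y p) (h : ∀ᶠ q in 𝓝 p, X q = Y q) :
    cov X p = cov Y p :=
  cov.isCovariantDerivativeOnUniv.congr_of_eventuallyEq hX hY Filter.univ_mem h

variable (cov) in
lemma curvature_antisymm (x y z : TangentSpace I p) :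
    curvature cov p x y z = - curvature cov p y x z := by
  simp only [curvature, curvatureField]
  rw [VectorField.mlieBracket_swap_apply, map_neg]
  abel

variable [FiniteDimensional ℝ E]

lemma IsLeviCivita.cov_sub_cov (hcov : IsLeviCivita g cov) (hX : VDiffAt I X p)
    (hY : VDiffAt I Y p) :
    cov Y p (X p) - cov X p (Y p) = VectorField.mlieBracket I X Y p :=
  cov.torsion_eq_zero_iff.1 hcov.torsion_free hX hY

lemma IsLeviCivita.mvfderiv_form_eventuallyEq (hcov : IsLeviCivita g cov) (hX : SmoothNear X p)
    (hY : SmoothNear Y p) :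
    ∀ᶠ q in 𝓝 p, ∀ v : TangentSpace I q, mvfderiv I (fun q ↦ g.form q (X q) (Y q)) q v
      = g.form q (cov X q v) (Y q) + g.form q (X q) (cov Y q v) := by
  filter_upwards [hX.eventually, hY.eventually] with q hq hq' v
  exact hcov.metric q v X Y hq.vDiffAt hq'.vDiffAt

variable [T2Space M]

/-- Torsion-freeness holds on a neighbourhood, so it may be differentiated. -/
lemma IsLeviCivita.cov_cov_sub (hcov : IsLeviCivita g cov) (hX : SmoothNear X p)
    (hY : SmoothNear Y p) :
    cov (fun q ↦ cov Y q (X q)) p - cov (fun q ↦ cov X q (Y q)) p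
      = cov (VectorField.mlieBracket I X Y) p := by
  have h₁ := hX.cov hcov.smooth hY
  have h₂ := hY.cov hcov.smooth hX
  rw [← cov_sub h₁.vDiffAt h₂.vDiffAt]
  refine cov_congr (h₁.sub h₂).vDiffAt (hX.mlieBracket hY).vDiffAt ?_
  filter_upwards [hX.eventually, hY.eventually] with q hq hq'
  exact hcov.cov_sub_cov hq.vDiffAt hq'.vDiffAt

/-- Vanishing torsion, used twice, turns the cyclic sum into iterated Lie brackets, which cancel by
the Jacobi identity. -/
lemma IsLeviCivita.curvatureField_bianchi (hcov : IsLeviCivita g cov) (hX : SmoothNear X p)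
    (hY : SmoothNear Y p)
    (hZ : SmoothNear Z p) :
    curvatureField cov X Y Z p + curvatureField cov Y Z X p + curvatureField cov Z X Y p = 0 := by
  have a₁ := congr($(hcov.cov_cov_sub hY hZ) (X p))
  have a₂ := congr($(hcov.cov_cov_sub hZ hX) (Y p))
  have a₃ := congr($(hcov.cov_cov_sub hX hY) (Z p))
  have b₁ := hcov.cov_sub_cov hX.vDiffAt (hY.mlieBracket hZ).vDiffAt
  have b₂ := hcov.cov_sub_cov hY.vDiffAt (hZ.mlieBracket hX).vDiffAt
  have b₃ := hcov.cov_sub_cov hZ.vDiffAt (hX.mlieBracket hY).vDiffAt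
  have j := leibniz_mlieBracket hX hY hZ
  have j₁ : VectorField.mlieBracket I (VectorField.mlieBracket I X Y) Z p
      = - VectorField.mlieBracket I Z (VectorField.mlieBracket I X Y) p :=
    VectorField.mlieBracket_swap_apply
  have j₂ : VectorField.mlieBracket I Y (VectorField.mlieBracket I X Z) p
      = - VectorField.mlieBracket I Y (VectorField.mlieBracket I Z X) p := by
    rw [VectorField.mlieBracket_swap (V := X)]
    have := VectorField.mlieBracket_const_smul_right (I := I) (V := Y) (c := (-1 : ℝ))
      (hZ.mlieBracket hX).vDiffAt
    simpa using this
  rw [j₁, j₂, ← b₁, ← b₂, ← b₃, ← a₁, ← a₂, ← a₃] at j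
  simp only [curvatureField, sub_apply] at j ⊢
  rw [← sub_eq_zero] at j
  rw [← j]
  abel

lemma IsLeviCivita.second_mvfderiv_form (hcov : IsLeviCivita g cov) (hX : SmoothNear X p)
    (hZ : SmoothNear Z p)
    (hW : SmoothNear W p) :
    MDifferentiableAt I 𝓘(ℝ, ℝ)
      (fun q ↦ mvfderiv I (fun q ↦ g.form q (Z q) (W q)) q (X q)) p ∧
    ∀ y : TangentSpace I p,
      mvfderiv I (fun q ↦ mvfderiv I (fun q ↦ g.form q (Z q) (W q)) q (X q)) p y
      = g.form p (cov (fun q ↦ cov Z q (X q)) p y) (W p)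
        + g.form p (cov Z p (X p)) (cov W p y)
        + (g.form p (cov Z p y) (cov W p (X p))
        + g.form p (Z p) (cov (fun q ↦ cov W q (X q)) p y)) := by
  have h₁ := hX.cov hcov.smooth hZ
  have h₂ := hX.cov hcov.smooth hW
  have d₁ : MDifferentiableAt I 𝓘(ℝ, ℝ) (fun q ↦ g.form q (cov Z q (X q)) (W q)) p :=
    (h₁.form g hW).self_of_nhds.mdifferentiableAt (by simp)
  have d₂ : MDifferentiableAt I 𝓘(ℝ, ℝ) (fun q ↦ g.form q (Z q) (cov W q (X q))) p :=
    (hZ.form g h₂).self_of_nhds.mdifferentiableAt (by simp)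
  have ev : (fun q ↦ mvfderiv I (fun q ↦ g.form q (Z q) (W q)) q (X q)) =ᶠ[𝓝 p]
      (fun q ↦ g.form q (cov Z q (X q)) (W q)) + fun q ↦ g.form q (Z q) (cov W q (X q)) := by
    filter_upwards [hcov.mvfderiv_form_eventuallyEq hZ hW] with q hq
    exact hq _
  refine ⟨(d₁.add d₂).congr_of_eventuallyEq ev, fun y ↦ ?_⟩
  rw [mvfderiv_congr ev, mvfderiv_add d₁ d₂, add_apply,
    hcov.metric p y _ _ h₁.vDiffAt hW.vDiffAt, hcov.metric p y _ _ hZ.vDiffAt h₂.vDiffAt]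

/-- The bracket `[X, Y]` acts on the function `g(Z, W)` as a commutator. Expanding with metric
compatibility, the mixed terms `g(∇Z, ∇W)` cancel. -/
lemma IsLeviCivita.curvatureField_skew (hcov : IsLeviCivita g cov) [Nontrivial E]
    (hX : SmoothNear X p) (hY : SmoothNear Y p)
    (hZ : SmoothNear Z p) (hW : SmoothNear W p) :
    g.form p (curvatureField cov X Y Z p) (W p)
      = - g.form p (Z p) (curvatureField cov X Y W p) := by
  obtain ⟨dX, eX⟩ := hcov.second_mvfderiv_form hX hZ hW
  obtain ⟨dY, eY⟩ := hcov.second_mvfderiv_form hY hZ hW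
  have h := mvfderiv_mlieBracket hX hY (hZ.form g hW) dX dY
  rw [eX, eY, hcov.metric p _ _ _ hZ.vDiffAt hW.vDiffAt] at h
  simp only [curvatureField, map_sub, sub_apply]
  linarith

/-- The curvature only depends on the values of the vector fields at the point. -/
lemma IsLeviCivita.curvatureField_eq_curvature (hcov : IsLeviCivita g cov) [Nontrivial E]
    (hX : SmoothNear X p)
    (hY : SmoothNear Y p) (hZ : SmoothNear Z p) :
    curvatureField cov X Y Z p = curvature cov p (X p) (Y p) (Z p) := by
  have pair : ∀ {X Y Z W : ∀ q : M, TangentSpace I q}, SmoothNear X p → SmoothNear Y p →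
      SmoothNear Z p → SmoothNear W p → g.form p (curvatureField cov X Y Z p) (W p)
        = g.form p (curvatureField cov Z W X p) (Y p) := by
    intro X Y Z W hX hY hZ hW
    refine curvature_pair_symm (α := {X : ∀ q : M, TangentSpace I q // SmoothNear X p})
      (fun X Y Z W ↦ g.form p (curvatureField cov X.1 Y.1 Z.1 p) (W.1 p)) ?_ ?_ ?_
      ⟨X, hX⟩ ⟨Y, hY⟩ ⟨Z, hZ⟩ ⟨W, hW⟩
    · intro X Y Z W
      rw [← neg_apply, ← map_neg]
      congr 2
      simp only [curvatureField]
      rw [VectorField.mlieBracket_swap_apply, map_neg]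
      abel
    · intro X Y Z W
      rw [hcov.curvatureField_skew X.2 Y.2 Z.2 W.2, g.symm]
    · intro X Y Z W
      rw [← add_apply, ← add_apply, ← map_add, ← map_add,
        hcov.curvatureField_bianchi X.2 Y.2 Z.2, map_zero]
      rfl
  -- Skewness moves `Z` out of the derivatives, so only `Z p` matters. Pair symmetry then brings `X`
  -- into the third slot and leaves `Y` outside the derivatives.
  have third : ∀ {X Y Z Z' : ∀ q : M, TangentSpace I q}, SmoothNear X p → SmoothNear Y p →
      SmoothNear Z p → SmoothNear Z' p → Z p = Z' p →
      curvatureField cov X Y Z p = curvatureField cov X Y Z' p := by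
    intro X Y Z Z' hX hY hZ hZ' h
    refine g.ext_form fun w ↦ ?_
    have hw := smoothNear_extend I w
    have e := FiberBundle.extend_apply_self E w
    have s₁ := hcov.curvatureField_skew hX hY hZ hw
    have s₂ := hcov.curvatureField_skew hX hY hZ' hw
    rw [e] at s₁ s₂
    rw [s₁, s₂, h]
  have ex : ∀ v : TangentSpace I p, FiberBundle.extend E v p = v := FiberBundle.extend_apply_self E
  have sm : ∀ v : TangentSpace I p, SmoothNear (FiberBundle.extend E v) p := smoothNear_extend I
  rw [third hX hY hZ (sm (Z p)) (ex _).symm]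
  refine g.ext_form fun w ↦ ?_
  have s₁ := pair hX hY (sm (Z p)) (sm w)
  have s₂ := pair (sm (X p)) (sm (Y p)) (sm (Z p)) (sm w)
  rw [ex w] at s₁ s₂
  rw [curvature, s₁, s₂, third (sm (Z p)) (sm w) hX (sm (X p)) (ex _).symm, ex (Y p)]

lemma IsLeviCivita.curvature_bianchi (hcov : IsLeviCivita g cov) (x y z : TangentSpace I p) :
    curvature cov p x y z + curvature cov p y z x + curvature cov p z x y = 0 :=
  hcov.curvatureField_bianchi (smoothNear_extend I x) (smoothNear_extend I y)
    (smoothNear_extend I z)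

lemma IsLeviCivita.curvature_skew (hcov : IsLeviCivita g cov) [Nontrivial E]
    (x y z w : TangentSpace I p) :
    g.form p (curvature cov p x y z) w = - g.form p (curvature cov p x y w) z := by
  have := hcov.curvatureField_skew (smoothNear_extend I x) (smoothNear_extend I y)
    (smoothNear_extend I z) (smoothNear_extend I w)
  rw [FiberBundle.extend_apply_self, FiberBundle.extend_apply_self, g.symm p z] at this
  exact this

end Curvature

end PhiNullOsserman

end

/-! ### Identities of the structure tensors and their covariant derivatives -/

noncomputable section

namespace PhiNullOsserman

namespace LorentzSStructure

section Pointwise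

variable {E : Type*} [NormedAddCommGroup E] [NormedSpace ℝ E]
  {H : Type*} [TopologicalSpace H] {I : ModelWithCorners ℝ E H}
  {M : Type*} [TopologicalSpace M] [ChartedSpace H M] [IsManifold I ∞ M]
  {s : ℕ} (S : LorentzSStructure I M s) {p : M}

lemma φ_ξ (α : Fin s) : S.φ p (S.ξ α p) = 0 := by
  have : S.ξ α p ∈ LinearMap.ker (S.φ p : TangentSpace I p →ₗ[ℝ] TangentSpace I p) := by
    rw [S.ker_φ]
    exact Submodule.subset_span ⟨α, rfl⟩
  exact this

lemma ε_mul_self (α : Fin s) : S.ε α * S.ε α = 1 := by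
  rcases S.causal α with ⟨h, -⟩ | ⟨h, -⟩ <;> rw [h] <;> norm_num

lemma form_ξ (α : Fin s) (y : TangentSpace I p) :
    S.g.form p (S.ξ α p) y = S.ε α * S.η α p y := by
  have h := S.compat p (S.ξ α p) y
  rw [S.φ_ξ, map_zero, zero_apply] at h
  simp only [S.η_ξ, mul_ite, mul_one, mul_zero, ite_mul, zero_mul, Finset.sum_ite_eq',
    Finset.mem_univ, if_true] at h
  linarith

lemma η_eq (α : Fin s) (y : TangentSpace I p) :
    S.η α p y = S.ε α * S.g.form p (S.ξ α p) y := by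
  rw [form_ξ, ← mul_assoc, ε_mul_self, one_mul]

/-- Compare `φ³x` computed as `φ²(φx)` and as `φ(φ²x)`, using that `φ` kills every `ξ_β`. -/
lemma η_φ (α : Fin s) (x : TangentSpace I p) : S.η α p (S.φ p x) = 0 := by
  have h := S.φ_sq p (S.φ p x)
  have h' := congr(S.φ p $(S.φ_sq p x))
  rw [h, map_add, map_neg, map_sum] at h'
  simp only [map_smul, φ_ξ, smul_zero, Finset.sum_const_zero] at h'
  have h'' : ∑ β, S.η β p (S.φ p x) • S.ξ β p = 0 := by
    rw [add_zero] at h'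
    exact add_eq_left.1 h'
  have := congr(S.η α p $h'')
  simpa [S.η_ξ] using this

/-- `φ` is skew-symmetric. -/
lemma form_φ (x y : TangentSpace I p) :
    S.g.form p (S.φ p x) y = - S.g.form p x (S.φ p y) := by
  have h := S.compat p x (S.φ p y)
  simp only [S.η_φ, mul_zero, Finset.sum_const_zero, sub_zero] at h
  rw [← h, S.φ_sq, map_add, map_neg, map_sum, neg_add, neg_neg]
  simp only [map_smul, S.g.symm p (S.φ p x) (S.ξ _ p), form_ξ, η_φ, mul_zero, smul_zero,
    Finset.sum_const_zero, neg_zero, add_zero]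

lemma smoothNear_ξ (α : Fin s) : SmoothNear (S.ξ α) p := .of_contMDiff (S.ξ_smooth α)

lemma smoothNear_φ {X : ∀ q : M, TangentSpace I q} (hX : SmoothNear X p) :
    SmoothNear (fun q ↦ S.φ q (X q)) p := hX.endo S.φ_smooth

variable (cov : CovariantDerivative I E (TangentSpace I : M → Type _))

variable (p) in
/-- The covariant derivative `(∇_x φ) y` at `p`. -/
def covφ (x y : TangentSpace I p) : TangentSpace I p :=
  cov (fun q ↦ S.φ q (FiberBundle.extend E y q)) p x - S.φ p (cov (FiberBundle.extend E y) p x)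

end Pointwise

section Connection

variable {E : Type*} [NormedAddCommGroup E] [NormedSpace ℝ E] [FiniteDimensional ℝ E]
  {H : Type*} [TopologicalSpace H] {I : ModelWithCorners ℝ E H}
  {M : Type*} [TopologicalSpace M] [ChartedSpace H M] [IsManifold I ∞ M]
  {s : ℕ} {S : LorentzSStructure I M s} {p : M}
  {cov : CovariantDerivative I E (TangentSpace I : M → Type _)}
  {Y Z : ∀ q : M, TangentSpace I q}

lemma mvfderiv_η (hcov : IsLeviCivita S.g cov) (α : Fin s) (hY : SmoothNear Y p)
    (x : TangentSpace I p) :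
    mvfderiv I (fun q ↦ S.η α q (Y q)) p x
      = S.ε α * S.g.form p (cov (S.ξ α) p x) (Y p) + S.η α p (cov Y p x) := by
  have hξ := S.smoothNear_ξ (p := p) α
  have : (fun q ↦ S.η α q (Y q)) = fun q ↦ S.ε α * S.g.form q (S.ξ α q) (Y q) := by
    funext q; rw [S.η_eq]
  have hd : MDifferentiableAt I 𝓘(ℝ, ℝ) (fun q ↦ S.g.form q (S.ξ α q) (Y q)) p :=
    (hξ.form S.g hY).self_of_nhds.mdifferentiableAt (by simp)
  have key := congr($(mvfderiv_mul (I := I) (x := p)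
    (f := fun _ ↦ S.ε α) (g := fun q ↦ S.g.form q (S.ξ α q) (Y q)) mdifferentiableAt_const hd) x)
  rw [this, S.η_eq]
  refine key.trans ?_
  simp [mvfderiv_const, hcov.metric p x _ _ hξ.vDiffAt hY.vDiffAt, mul_add]

/-- The exterior derivative of `η^α` in terms of `∇ξ_α`. -/
lemma form_cov_ξ_sub (hcov : IsLeviCivita S.g cov) (α : Fin s) (x y : TangentSpace I p) :
    S.g.form p (cov (S.ξ α) p x) y - S.g.form p (cov (S.ξ α) p y) x
      = 2 * S.ε α * S.g.form p x (S.φ p y) := by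
  have hx := smoothNear_extend I x
  have hy := smoothNear_extend I y
  have h := S.dη_eq α p _ _ hx.vDiffAt hy.vDiffAt
  rw [extDerivOneForm, mvfderiv_η hcov α hx, mvfderiv_η hcov α hy,
    ← hcov.cov_sub_cov hx.vDiffAt hy.vDiffAt, map_sub] at h
  simp only [FiberBundle.extend_apply_self] at h
  linear_combination 2 * S.ε α * h -
    (S.g.form p (cov (S.ξ α) p x) y - S.g.form p (cov (S.ξ α) p y) x) * S.ε_mul_self α

lemma form_cov_ξ_ξ (hcov : IsLeviCivita S.g cov) (α β : Fin s) (x : TangentSpace I p) :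
    S.g.form p (cov (S.ξ α) p x) (S.ξ β p) + S.g.form p (S.ξ α p) (cov (S.ξ β) p x) = 0 := by
  rw [← hcov.metric p x _ _ (S.smoothNear_ξ α).vDiffAt (S.smoothNear_ξ β).vDiffAt]
  simp only [S.form_ξ, S.η_ξ, mvfderiv_const]
  rfl

/-- `∇_x φ` is skew-symmetric. -/
lemma cov_φ_skew (hcov : IsLeviCivita S.g cov) (hY : SmoothNear Y p) (hZ : SmoothNear Z p)
    (x : TangentSpace I p) :
    S.g.form p (cov (fun q ↦ S.φ q (Y q)) p x - S.φ p (cov Y p x)) (Z p)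
      = - S.g.form p (cov (fun q ↦ S.φ q (Z q)) p x - S.φ p (cov Z p x)) (Y p) := by
  have h₁ := hcov.metric p x _ _ (S.smoothNear_φ hY).vDiffAt hZ.vDiffAt
  have h₂ := hcov.metric p x _ _ (S.smoothNear_φ hZ).vDiffAt hY.vDiffAt
  have h₃ : (fun q ↦ S.g.form q (S.φ q (Y q)) (Z q))
      = -fun q ↦ S.g.form q (S.φ q (Z q)) (Y q) := by
    funext q
    rw [Pi.neg_apply, S.form_φ, S.g.symm]
  rw [h₃, mvfderiv_neg, neg_apply, h₂] at h₁
  simp only [map_sub, sub_apply]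
  have e₁ := S.form_φ (cov Y p x) (Z p)
  have e₂ := S.form_φ (cov Z p x) (Y p)
  have e₃ := S.g.symm p (S.φ p (Y p)) (cov Z p x)
  have e₄ := S.g.symm p (S.φ p (Z p)) (cov Y p x)
  linarith

/-- Tensoriality of `∇φ`: by skewness, the pairing with `w` involves the field `Y` only through `Y
p`. -/
lemma cov_φ_sub (hcov : IsLeviCivita S.g cov) (hY : SmoothNear Y p) (x : TangentSpace I p) :
    cov (fun q ↦ S.φ q (Y q)) p x - S.φ p (cov Y p x) = S.covφ p cov x (Y p) := by
  refine S.g.ext_form fun w ↦ ?_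
  have hw := smoothNear_extend I w
  have h₁ := cov_φ_skew hcov hY hw x
  have h₂ := cov_φ_skew hcov (smoothNear_extend I (Y p)) hw x
  simp only [FiberBundle.extend_apply_self] at h₁ h₂
  rw [covφ, h₁, h₂]

lemma form_covφ (hcov : IsLeviCivita S.g cov) (x y z : TangentSpace I p) :
    S.g.form p (S.covφ p cov x y) z = - S.g.form p (S.covφ p cov x z) y := by
  have h := cov_φ_skew hcov (smoothNear_extend I y) (smoothNear_extend I z) x
  simp only [FiberBundle.extend_apply_self] at h
  exact h

lemma covφ_ξ (hcov : IsLeviCivita S.g cov) (α : Fin s) (x : TangentSpace I p) :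
    S.covφ p cov x (S.ξ α p) = - S.φ p (cov (S.ξ α) p x) := by
  rw [← cov_φ_sub hcov (S.smoothNear_ξ α)]
  have : (fun q ↦ S.φ q (S.ξ α q)) = 0 := by funext q; exact S.φ_ξ α
  rw [this, cov.zero]
  simp

/-- Normality in terms of `∇φ`. -/
lemma covφ_normal (hcov : IsLeviCivita S.g cov) (x y : TangentSpace I p) :
    S.covφ p cov (S.φ p x) y - S.covφ p cov (S.φ p y) x + S.φ p (S.covφ p cov y x)
      - S.φ p (S.covφ p cov x y) = -(2 * S.g.form p x (S.φ p y)) • S.ξtilde p := by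
  have hx := smoothNear_extend I x
  have hy := smoothNear_extend I y
  have hφx := S.smoothNear_φ hx
  have hφy := S.smoothNear_φ hy
  have h := S.normal p _ _ hx.vDiffAt hy.vDiffAt
  simp only [S.dη_eq _ p _ _ hx.vDiffAt hy.vDiffAt] at h
  -- Writing each bracket as a difference of covariant derivatives, the derivatives of the two
  -- fields cancel and only those of `φ` survive.
  rw [nijenhuis, ← hcov.cov_sub_cov hφx.vDiffAt hφy.vDiffAt,
    ← hcov.cov_sub_cov hφx.vDiffAt hy.vDiffAt, ← hcov.cov_sub_cov hx.vDiffAt hφy.vDiffAt,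
    ← hcov.cov_sub_cov hx.vDiffAt hy.vDiffAt] at h
  simp only [FiberBundle.extend_apply_self, map_sub, ← Finset.smul_sum] at h
  simp only [covφ, map_sub, ξtilde]
  rw [neg_smul, ← add_eq_zero_iff_eq_neg, ← h]
  abel

variable [T2Space M]

/-- The derivative of `form_cov_ξ_sub`: it expresses `∇Φ` through second covariant derivatives of
`ξ_α`. -/
lemma form_covφ_eq (hcov : IsLeviCivita S.g cov) (α : Fin s) (hY : SmoothNear Y p)
    (hZ : SmoothNear Z p)
    (x : TangentSpace I p) :
    2 * S.ε α * S.g.form p (Y p) (S.covφ p cov x (Z p))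
      = S.g.form p (cov (fun q ↦ cov (S.ξ α) q (Y q)) p x - cov (S.ξ α) p (cov Y p x)) (Z p)
       - S.g.form p (cov (fun q ↦ cov (S.ξ α) q (Z q)) p x - cov (S.ξ α) p (cov Z p x))
        (Y p) := by
  have hξ := S.smoothNear_ξ (p := p) α
  have hφZ := S.smoothNear_φ hZ
  have hYξ := hY.cov hcov.smooth hξ
  have hZξ := hZ.cov hcov.smooth hξ
  have d₁ : MDifferentiableAt I 𝓘(ℝ, ℝ) (fun q ↦ S.g.form q (cov (S.ξ α) q (Y q)) (Z q)) p :=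
    (hYξ.form S.g hZ).self_of_nhds.mdifferentiableAt (by simp)
  have d₂ : MDifferentiableAt I 𝓘(ℝ, ℝ) (fun q ↦ S.g.form q (cov (S.ξ α) q (Z q)) (Y q)) p :=
    (hZξ.form S.g hY).self_of_nhds.mdifferentiableAt (by simp)
  have d₃ : MDifferentiableAt I 𝓘(ℝ, ℝ) (fun q ↦ S.g.form q (Y q) (S.φ q (Z q))) p :=
    (hY.form S.g hφZ).self_of_nhds.mdifferentiableAt (by simp)
  have e : (fun q ↦ S.g.form q (cov (S.ξ α) q (Y q)) (Z q))
      - (fun q ↦ S.g.form q (cov (S.ξ α) q (Z q)) (Y q))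
      = (fun _ ↦ 2 * S.ε α) * fun q ↦ S.g.form q (Y q) (S.φ q (Z q)) := by
    funext q
    exact form_cov_ξ_sub hcov α (Y q) (Z q)
  have h := congr(mvfderiv I $e p x)
  rw [mvfderiv_sub d₁ d₂, mvfderiv_mul mdifferentiableAt_const d₃, sub_apply,
    hcov.metric p _ _ _ hYξ.vDiffAt hZ.vDiffAt, hcov.metric p _ _ _ hZξ.vDiffAt hY.vDiffAt] at h
  simp only [mvfderiv_const, smul_zero, add_zero, smul_apply, smul_eq_mul,
    hcov.metric p _ _ _ hY.vDiffAt hφZ.vDiffAt] at h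
  have k₁ := form_cov_ξ_sub hcov α (cov Y p x) (Z p)
  have k₂ := form_cov_ξ_sub hcov α (Y p) (cov Z p x)
  rw [← cov_φ_sub hcov hZ]
  simp only [map_sub, sub_apply]
  linarith

/-- The fundamental form is closed. -/
lemma covφ_cyclic (hcov : IsLeviCivita S.g cov) [Nontrivial E] (α : Fin s)
    (x y z : TangentSpace I p) :
    S.g.form p y (S.covφ p cov x z) + S.g.form p z (S.covφ p cov y x)
      + S.g.form p x (S.covφ p cov z y) = 0 := by
  have hx := smoothNear_extend I x
  have hy := smoothNear_extend I y
  have hz := smoothNear_extend I z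
  have hξ := S.smoothNear_ξ (p := p) α
  -- In the cyclic sum the second derivatives of `ξ_α` combine to `g(R(x, y)ξ_α, z)` and its cyclic
  -- permutations. By skewness their sum is the Bianchi sum paired with `ξ_α`.
  have h₁ := form_covφ_eq hcov α hy hz x
  have h₂ := form_covφ_eq hcov α hz hx y
  have h₃ := form_covφ_eq hcov α hx hy z
  have r₁ := hcov.curvatureField_skew hx hy hξ hz
  have r₂ := hcov.curvatureField_skew hy hz hξ hx
  have r₃ := hcov.curvatureField_skew hz hx hξ hy
  have b := congr(S.g.form p (S.ξ α p) $(hcov.curvatureField_bianchi hx hy hz))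
  simp only [map_add, map_zero] at b
  simp only [curvatureField, ← hcov.cov_sub_cov hx.vDiffAt hy.vDiffAt,
    ← hcov.cov_sub_cov hy.vDiffAt hz.vDiffAt, ← hcov.cov_sub_cov hz.vDiffAt hx.vDiffAt]
    at r₁ r₂ r₃ b
  simp only [FiberBundle.extend_apply_self, map_sub, sub_apply] at h₁ h₂ h₃ r₁ r₂ r₃ b
  have : 2 * S.ε α * (S.g.form p y (S.covφ p cov x z) + S.g.form p z (S.covφ p cov y x)
      + S.g.form p x (S.covφ p cov z y)) = 0 := by
    linarith
  refine (mul_eq_zero.1 this).resolve_left ?_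
  have := S.ε_mul_self α
  intro h0
  nlinarith

end Connection

end LorentzSStructure

end PhiNullOsserman

end

/-! ### The formulas for `∇ξ_α`, `∇φ` and `R(x, y)ξ_α` -/

noncomputable section

namespace PhiNullOsserman

namespace LorentzSStructure

variable {E : Type*} [NormedAddCommGroup E] [NormedSpace ℝ E]
  {H : Type*} [TopologicalSpace H] {I : ModelWithCorners ℝ E H}
  {M : Type*} [TopologicalSpace M] [ChartedSpace H M] [IsManifold I ∞ M]

section General

variable {s : ℕ} {S : LorentzSStructure I M s} {p : M}

lemma form_ξtilde (x : TangentSpace I p) : S.g.form p (S.ξtilde p) x = S.ηtilde p x := by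
  simp [ξtilde, ηtilde, form_ξ]

lemma form_decomp (x y : TangentSpace I p) :
    S.g.form p x y = - S.g.form p x (S.φ p (S.φ p y))
      + ∑ α, S.η α p y * S.g.form p x (S.ξ α p) := by
  rw [S.φ_sq, map_add, map_neg, map_sum]
  simp

variable [FiniteDimensional ℝ E] {cov : CovariantDerivative I E (TangentSpace I : M → Type _)}

lemma form_cov_ξ_ξ_eq_zero (hcov : IsLeviCivita S.g cov) (α β : Fin s) (x : TangentSpace I p) :
    S.g.form p (cov (S.ξ α) p x) (S.ξ β p) = 0 := by
  have anti : ∀ (α β : Fin s) x, S.g.form p (cov (S.ξ α) p x) (S.ξ β p)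
      = - S.g.form p (cov (S.ξ β) p x) (S.ξ α p) := by
    intro α β x
    have := form_cov_ξ_ξ hcov α β x
    rw [S.g.symm p (S.ξ α p)] at this
    linarith
  have symm : ∀ (α β : Fin s) x, S.g.form p (cov (S.ξ α) p x) (S.ξ β p)
      = S.g.form p (cov (S.ξ α) p (S.ξ β p)) x := by
    intro α β x
    have := form_cov_ξ_sub hcov α x (S.ξ β p)
    rw [S.φ_ξ, map_zero, mul_zero] at this
    linarith
  -- By `anti` and `symm`, an expression in three indices that is skew in one pair and symmetric in
  -- another; such an expression vanishes.
  have hξ : ∀ γ, S.g.form p (cov (S.ξ α) p (S.ξ γ p)) (S.ξ β p) = 0 := by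
    intro γ
    linarith [symm α β (S.ξ γ p), anti α γ (S.ξ β p), symm γ α (S.ξ β p), anti γ β (S.ξ α p),
      symm β γ (S.ξ α p), anti β α (S.ξ γ p), anti α β (S.ξ γ p)]
  -- Normality makes the `Im φ` part of `∇_{ξ_α} ξ_β` symmetric in `α, β`, while `anti` and `symm`
  -- make it skew.
  have n := congr(S.g.form p $(covφ_normal hcov (S.ξ α p) (S.ξ β p)) x)
  have d : ∀ x, S.covφ p cov 0 x = 0 := by simp [covφ]
  simp only [S.φ_ξ, d, covφ_ξ hcov, map_zero, mul_zero, neg_zero, zero_smul, sub_zero, map_add,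
    map_sub, map_neg, add_apply, sub_apply, neg_apply, zero_apply, S.form_φ, neg_neg] at n
  have h := form_decomp (S := S) (cov (S.ξ α) p (S.ξ β p)) x
  have : ∀ γ, S.g.form p (cov (S.ξ α) p (S.ξ β p)) (S.ξ γ p) = 0 := fun γ ↦ by
    rw [← symm, hξ]
  simp only [this, mul_zero, Finset.sum_const_zero, add_zero] at h
  rw [symm, h]
  linarith [symm α β (S.φ p (S.φ p x)), anti α β (S.φ p (S.φ p x)), symm β α (S.φ p (S.φ p x))]

variable [T2Space M] [Nontrivial E]

/-- The Killing equation for `ξ_α` on `Im φ`. Normality at `(x, ξ_α)` relates `∇ξ_α` to `∇_{ξ_α} φ`,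
and closedness of `Φ` eliminates the latter. -/
lemma form_cov_ξ_φ_symm (hcov : IsLeviCivita S.g cov) (α : Fin s) (x z : TangentSpace I p) :
    S.g.form p (cov (S.ξ α) p (S.φ p x)) (S.φ p z)
      + S.g.form p (cov (S.ξ α) p (S.φ p z)) (S.φ p x) = 0 := by
  have n := congr(S.g.form p $(covφ_normal hcov x (S.ξ α p)) z)
  have c := covφ_cyclic hcov α (S.φ p z) x (S.ξ α p)
  have k := form_covφ hcov x (S.φ p z) (S.ξ α p)
  have d : S.covφ p cov 0 x = 0 := by simp [covφ]
  simp only [S.φ_ξ, d, covφ_ξ hcov, map_zero, mul_zero, neg_zero, zero_smul, sub_zero, map_add,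
    map_sub, map_neg, add_apply, sub_apply, neg_apply, zero_apply] at n c k
  have e₁ := S.form_φ (cov (S.ξ α) p (S.φ p x)) z
  have e₂ := S.form_φ (S.covφ p cov (S.ξ α p) x) z
  have e₃ := S.form_φ (S.φ p (cov (S.ξ α) p x)) z
  have e₄ := S.form_φ x (cov (S.ξ α) p (S.φ p z))
  have e₅ := S.g.symm p (S.φ p z) (S.covφ p cov (S.ξ α p) x)
  have e₆ := S.g.symm p (S.ξ α p) (S.covφ p cov x (S.φ p z))
  have e₇ := S.g.symm p (S.φ p x) (cov (S.ξ α) p (S.φ p z))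
  linarith

/-- `∇_x ξ_α = -ε_α φ x`. -/
lemma cov_ξ (hcov : IsLeviCivita S.g cov) (α : Fin s) (x : TangentSpace I p) :
    cov (S.ξ α) p x = -(S.ε α • S.φ p x) := by
  have ξx : ∀ (β : Fin s) x, S.g.form p (S.φ p x) (S.ξ β p) = 0 := fun β x ↦ by
    rw [S.form_φ, S.φ_ξ, map_zero, neg_zero]
  -- The form `g(∇_x ξ_α + ε_α φx, y)` is symmetric because `dη^α = Φ`. It vanishes for `y = ξ_β`,
  -- so `red` and `symm` reduce both arguments to `Im φ`, where the Killing equation makes it skew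
  -- as well.
  have symm : ∀ x y, S.g.form p (cov (S.ξ α) p x) y + S.ε α * S.g.form p (S.φ p x) y
      = S.g.form p (cov (S.ξ α) p y) x + S.ε α * S.g.form p (S.φ p y) x := by
    intro x y
    have h := form_cov_ξ_sub hcov α x y
    have e := S.form_φ x y
    rw [S.g.symm p (S.φ p y), e]
    linarith
  have red : ∀ x y, S.g.form p (cov (S.ξ α) p x) y + S.ε α * S.g.form p (S.φ p x) y
      = -(S.g.form p (cov (S.ξ α) p x) (S.φ p (S.φ p y))
        + S.ε α * S.g.form p (S.φ p x) (S.φ p (S.φ p y))) := by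
    intro x y
    have h₁ := form_decomp (S := S) (cov (S.ξ α) p x) y
    have h₂ := form_decomp (S := S) (S.φ p x) y
    simp only [form_cov_ξ_ξ_eq_zero hcov, ξx, mul_zero, Finset.sum_const_zero, add_zero] at h₁ h₂
    rw [h₁, h₂]
    ring
  refine S.g.ext_form fun y ↦ ?_
  rw [map_neg, map_smul, neg_apply, smul_apply, smul_eq_mul, eq_neg_iff_add_eq_zero, red, symm, red,
    neg_neg]
  have h₁ := form_cov_ξ_φ_symm hcov α (S.φ p y) (S.φ p x)
  have h₂ := symm (S.φ p (S.φ p y)) (S.φ p (S.φ p x))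
  have h₃ := S.form_φ (S.φ p (S.φ p y)) (S.φ p (S.φ p x))
  have h₄ := S.g.symm p (S.φ p (S.φ p (S.φ p x))) (S.φ p (S.φ p y))
  have h₅ := congr(S.ε α * $h₃)
  have h₆ := congr(S.ε α * $h₄)
  simp only [mul_neg] at h₅ h₆
  linarith

end General

section Two

variable {S : LorentzSStructure I M 2} {p : M}
  [FiniteDimensional ℝ E] [T2Space M] [Nontrivial E]
  {cov : CovariantDerivative I E (TangentSpace I : M → Type _)}

/-- The covariant derivative of `φ² = -I + ∑ η^α ⊗ ξ_α`, with `∇ξ_α = -ε_α φ` inserted. -/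
lemma covφ_φ (hcov : IsLeviCivita S.g cov) (x y : TangentSpace I p) :
    S.covφ p cov x (S.φ p y) + S.φ p (S.covφ p cov x y)
      = S.g.form p x (S.φ p y) • S.ξtilde p - S.ηtilde p y • S.φ p x := by
  have hy := smoothNear_extend I y
  have hφy := S.smoothNear_φ hy
  have hη : ∀ α, MDifferentiableAt I 𝓘(ℝ, ℝ) (fun q ↦ S.η α q (FiberBundle.extend E y q)) p :=
    fun α ↦ (hy.oneForm (S.η_smooth α)).self_of_nhds.mdifferentiableAt (by simp)
  have hξ := fun α ↦ (S.smoothNear_ξ (p := p) α).vDiffAt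
  have e : (fun q ↦ S.φ q (S.φ q (FiberBundle.extend E y q)))
      = ((-1 : ℝ) • FiberBundle.extend E y + (fun q ↦ S.η 0 q (FiberBundle.extend E y q)) • S.ξ 0)
        + (fun q ↦ S.η 1 q (FiberBundle.extend E y q)) • S.ξ 1 := by
    funext q
    simp [S.φ_sq, Fin.sum_univ_two, add_assoc]
  have h := cov_φ_sub hcov hφy x
  have h1 : VDiffAt I ((-1 : ℝ) • FiberBundle.extend E y) p :=
    (mdifferentiableAt_const (c := (-1 : ℝ))).smul_section hy.vDiffAt
  have h2 : ∀ α, VDiffAt I ((fun q ↦ S.η α q (FiberBundle.extend E y q)) • S.ξ α) p :=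
    fun α ↦ (hη α).smul_section (hξ α)
  rw [e, cov_add (mdifferentiableAt_add_section h1 (h2 0)) (h2 1), cov_add h1 (h2 0),
    cov_const_smul _ hy.vDiffAt,
    cov.isCovariantDerivativeOnUniv.leibniz (hξ 0) (hη 0),
    cov.isCovariantDerivativeOnUniv.leibniz (hξ 1) (hη 1)] at h
  simp only [FiberBundle.extend_apply_self, add_apply, smul_apply,
    ContinuousLinearMap.smulRight_apply, mvfderiv_η hcov _ hy] at h
  have hh : ∀ α x, cov.toFun (S.ξ α) p x = -(S.ε α • S.φ p x) := fun α x ↦ cov_ξ hcov α x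
  simp only [hh, map_neg, map_smul, neg_apply, smul_apply, smul_eq_mul, mul_neg, ← mul_assoc,
    S.ε_mul_self, one_mul] at h
  rw [← h, covφ, map_sub, S.φ_sq p (cov _ p x), S.form_φ x y]
  simp only [Fin.sum_univ_two, ξtilde, ηtilde]
  module

/-- The counterpart of the proof that an integrable almost Hermitian structure with closed
fundamental form is Kähler. The derivative of `φ²` (`P`), normality (`N`), closedness (`C`) and
skewness (`K`) form a linear system for `g((∇_x φ)y, z)`; the `ξ̃` term is what the `ξ_α` leave
over. -/
lemma covφ_apply_φ (hcov : IsLeviCivita S.g cov) (z y : TangentSpace I p) :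
    S.covφ p cov z (S.φ p y) = S.g.form p z (S.φ p y) • S.ξtilde p := by
  have P : ∀ x y z, S.g.form p (S.covφ p cov x (S.φ p y)) z
      - S.g.form p (S.covφ p cov x y) (S.φ p z)
      = S.g.form p x (S.φ p y) * S.ηtilde p z - S.ηtilde p y * S.g.form p (S.φ p x) z := by
    intro x y z
    have h := congr(S.g.form p $(covφ_φ hcov x y) z)
    simpa only [map_add, map_sub, map_smul, add_apply, sub_apply, smul_apply, smul_eq_mul,
      form_ξtilde, S.form_φ (S.covφ p cov x y) z, ← sub_eq_add_neg] using h
  have N : ∀ x y z, S.g.form p (S.covφ p cov (S.φ p x) y) z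
      - S.g.form p (S.covφ p cov (S.φ p y) x) z
      - S.g.form p (S.covφ p cov y x) (S.φ p z) + S.g.form p (S.covφ p cov x y) (S.φ p z)
      = -(2 * S.g.form p x (S.φ p y) * S.ηtilde p z) := by
    intro x y z
    have h := congr(S.g.form p $(covφ_normal hcov x y) z)
    simp only [map_add, map_sub, map_smul, add_apply, sub_apply, smul_apply, smul_eq_mul,
      form_ξtilde, S.form_φ (S.covφ p cov _ _) z] at h
    linarith
  have C : ∀ x y z, S.g.form p (S.covφ p cov x z) y + S.g.form p (S.covφ p cov y x) z
      + S.g.form p (S.covφ p cov z y) x = 0 := by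
    intro x y z
    rw [S.g.symm p _ y, S.g.symm p _ z, S.g.symm p _ x]
    exact covφ_cyclic hcov 0 x y z
  have K := form_covφ (p := p) hcov
  refine S.g.ext_form fun x ↦ ?_
  rw [map_smul, smul_apply, smul_eq_mul, form_ξtilde]
  have f : ∀ a b, S.g.form p b (S.φ p a) = - S.g.form p a (S.φ p b) := fun a b ↦ by
    rw [S.g.symm, S.form_φ]
  have n := N x y z
  have p₁ := P y x z
  have p₂ := P x y z
  have p₃ := P z y x
  rw [S.form_φ, f x y] at p₁
  rw [S.form_φ, f z x] at p₂
  rw [S.form_φ, f y z] at p₃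
  rw [f y z]
  linarith [C (S.φ p x) z y, C (S.φ p y) z x, K y z (S.φ p x), K x z (S.φ p y), K z y (S.φ p x)]

/-- `(∇_x φ) y = g(φx, φy) ξ̃ + η̃(y) φ² x`. -/
lemma covφ_eq (hcov : IsLeviCivita S.g cov) (x y : TangentSpace I p) :
    S.covφ p cov x y = S.g.form p (S.φ p x) (S.φ p y) • S.ξtilde p
      + S.ηtilde p y • S.φ p (S.φ p x) := by
  refine S.g.ext_form fun z ↦ ?_
  rw [form_covφ hcov, form_decomp, ← form_covφ hcov, covφ_apply_φ hcov]
  have : ∀ α, S.g.form p (S.covφ p cov x z) (S.ξ α p)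
      = - (S.ε α * S.g.form p (S.φ p (S.φ p x)) z) := by
    intro α
    rw [form_covφ hcov, covφ_ξ hcov, cov_ξ hcov]
    simp
  simp only [this, map_add, map_smul, add_apply, smul_apply, smul_eq_mul, form_ξtilde, ηtilde,
    Fin.sum_univ_two, S.form_φ x]
  ring

/-- `R(x, y) ξ_α = ε_α (η̃(x) φ² y - η̃(y) φ² x)`. -/
lemma curvature_ξ (hcov : IsLeviCivita S.g cov) (α : Fin 2) (x y : TangentSpace I p) :
    curvature cov p x y (S.ξ α p) = S.ε α • (S.ηtilde p x • S.φ p (S.φ p y)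
      - S.ηtilde p y • S.φ p (S.φ p x)) := by
  have hx := smoothNear_extend I x
  have hy := smoothNear_extend I y
  have hξ := S.smoothNear_ξ (p := p) α
  -- `curvature` extends the value of `ξ_α` at `p` by another field; tensoriality permits computing
  -- with the field `ξ_α` itself.
  have h := hcov.curvatureField_eq_curvature hx hy hξ
  simp only [FiberBundle.extend_apply_self] at h
  have e : ∀ Y : (∀ q : M, TangentSpace I q), (fun q ↦ cov (S.ξ α) q (Y q))
      = (-S.ε α) • fun q ↦ S.φ q (Y q) := by
    intro Y
    funext q
    simp [cov_ξ hcov]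
  rw [← h, curvatureField, e, e, cov_const_smul _ (S.smoothNear_φ hx).vDiffAt,
    cov_const_smul _ (S.smoothNear_φ hy).vDiffAt, cov_ξ hcov,
    ← hcov.cov_sub_cov hx.vDiffAt hy.vDiffAt]
  have h₁ := covφ_eq hcov x y
  -- Up to the factor `-ε_α`, the curvature is `(∇_x φ)y - (∇_y φ)x`, in which the symmetric `ξ̃`
  -- terms cancel.
  have h₂ := covφ_eq hcov y x
  rw [S.g.symm p (S.φ p y)] at h₂
  have h₃ : S.covφ p cov x y - S.covφ p cov y x
      = S.ηtilde p y • S.φ p (S.φ p x) - S.ηtilde p x • S.φ p (S.φ p y) := by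
    rw [h₁, h₂]; abel
  rw [← neg_sub (S.ηtilde p y • _), ← h₃, covφ, covφ]
  simp only [FiberBundle.extend_apply_self, map_sub, smul_apply]
  module

end Two

end LorentzSStructure

end PhiNullOsserman

end

/-! ### Algebraic curvature tensors -/

noncomputable section

namespace PhiNullOsserman

section Algebraic

variable {V : Type*} [AddCommGroup V] [Module ℝ V]

/-- `R` is an algebraic curvature tensor with respect to the bilinear form `g`. -/
structure IsAlgCurvature (g : V →ₗ[ℝ] V →ₗ[ℝ] ℝ) (R : V →ₗ[ℝ] V →ₗ[ℝ] V →ₗ[ℝ] V) : Prop where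
  antisymm : ∀ x y z, R x y z = -R y x z
  bianchi : ∀ x y z, R x y z + R y z x + R z x y = 0
  skew : ∀ x y z w, g (R x y z) w = -g (R x y w) z

variable {g : V →ₗ[ℝ] V →ₗ[ℝ] ℝ} {R R' : V →ₗ[ℝ] V →ₗ[ℝ] V →ₗ[ℝ] V}

lemma IsAlgCurvature.pair_symm (hR : IsAlgCurvature g R) (x y z w : V) :
    g (R x y z) w = g (R z w x) y := by
  refine curvature_pair_symm (fun x y z w ↦ g (R x y z) w) ?_ hR.skew ?_ x y z w
  · intro x y z w
    simp only [hR.antisymm x y, map_neg, LinearMap.neg_apply]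
  · intro x y z w
    simp only [← LinearMap.add_apply, ← map_add]
    rw [hR.bianchi, map_zero, LinearMap.zero_apply]

lemma IsAlgCurvature.sub (hR : IsAlgCurvature g R) (hR' : IsAlgCurvature g R') :
    IsAlgCurvature g (R - R') where
  antisymm x y z := by
    simp only [LinearMap.sub_apply, hR.antisymm x y, hR'.antisymm x y]; abel
  bianchi x y z := by
    have h := hR.bianchi x y z
    have h' := hR'.bianchi x y z
    simp only [LinearMap.sub_apply]
    rw [← sub_self (0 : V)]
    nth_rw 1 [← h]
    rw [← h']
    abel
  skew x y z w := by
    simp only [LinearMap.sub_apply, map_sub, hR.skew x y z, hR'.skew x y z]; ring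

lemma IsAlgCurvature.smul (hR : IsAlgCurvature g R) (c : ℝ) : IsAlgCurvature g (c • R) where
  antisymm x y z := by simp [hR.antisymm x y]
  bianchi x y z := by simp [← smul_add, hR.bianchi x y z]
  skew x y z w := by simp [hR.skew x y z]

/-- An algebraic curvature tensor is determined by its sectional curvatures. -/
lemma IsAlgCurvature.eq_of_sectional (hR : IsAlgCurvature g R) (hR' : IsAlgCurvature g R')
    (nondeg : ∀ v, (∀ w, g v w = 0) → v = 0)
    (h : ∀ x y, g (R x y y) x = g (R' x y y) x) : R = R' := by
  have hT := hR.sub hR'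
  set T := R - R' with hTdef
  have h0 : ∀ x y, g (T x y y) x = 0 := by
    intro x y; simp [hTdef, h]
  -- Polarization in `x` with pair symmetry, then in `y`. The tensor becomes totally skew in its
  -- three arguments, and Bianchi reads `3T = 0`.
  have h1 : ∀ x y w, g (T x y y) w = 0 := by
    intro x y w
    have := h0 (x + w) y
    simp only [map_add, LinearMap.add_apply, h0] at this
    have e := hT.pair_symm w y y x
    rw [hT.antisymm y x, map_neg, LinearMap.neg_apply] at e
    linarith [hT.skew x y y w]
  have h2 : ∀ x y z w, g (T x y z) w = - g (T x z y) w := by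
    intro x y z w
    have := h1 x (y + z) w
    simp only [map_add, LinearMap.add_apply, h1] at this
    linarith
  have h3 : ∀ x y z w, g (T x y z) w = 0 := by
    intro x y z w
    have b := congr(g $(hT.bianchi x y z) w)
    simp only [map_add, LinearMap.add_apply, map_zero, LinearMap.zero_apply] at b
    have e₁ := h2 y z x w
    have e₂ := h2 x z y w
    have a₁ := congr(g $(hT.antisymm x y z) w)
    have a₂ := congr(g $(hT.antisymm x z y) w)
    simp only [map_neg, LinearMap.neg_apply] at a₁ a₂
    linarith
  ext x y z
  have := nondeg (T x y z) (h3 x y z)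
  simpa [hTdef, sub_eq_zero] using this

variable (g) in
/-- The curvature tensor `(x, y, v) ↦ g(y, v) x - g(x, v) y`. -/
def constCurvature : V →ₗ[ℝ] V →ₗ[ℝ] V →ₗ[ℝ] V :=
  LinearMap.mk₂ ℝ (fun x y ↦ (g y).smulRight x - (g x).smulRight y)
    (fun x x' y ↦ by ext; simp; module) (fun c x y ↦ by ext; simp; module)
    (fun x x' y ↦ by ext; simp; module) (fun c x y ↦ by ext; simp; module)

@[simp] lemma constCurvature_apply (x y v : V) :
    constCurvature g x y v = g y v • x - g x v • y := rfl

variable (g) in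
/-- The curvature tensor
`(x, y, v) ↦ g(Jy, v) Jx - g(Jx, v) Jy + 2 g(x, Jy) Jv` of an endomorphism `J`. -/
def endCurvature (J : Module.End ℝ V) : V →ₗ[ℝ] V →ₗ[ℝ] V →ₗ[ℝ] V :=
  LinearMap.mk₂ ℝ (fun x y ↦ (g (J y)).smulRight (J x) - (g (J x)).smulRight (J y)
      + (2 * g x (J y)) • J)
    (fun x x' y ↦ by ext; simp; module) (fun c x y ↦ by ext; simp; module)
    (fun x x' y ↦ by ext; simp; module) (fun c x y ↦ by ext; simp; module)

@[simp] lemma endCurvature_apply (J : Module.End ℝ V) (x y v : V) :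
    endCurvature g J x y v = g (J y) v • J x - g (J x) v • J y + (2 * g x (J y)) • J v := rfl

lemma isAlgCurvature_constCurvature (symm : ∀ x y, g x y = g y x) :
    IsAlgCurvature g (constCurvature g) where
  antisymm x y z := by simp
  bianchi x y z := by
    simp only [constCurvature_apply, symm z y, symm z x, symm y x]; abel
  skew x y z w := by
    simp only [constCurvature_apply, map_sub, map_smul, LinearMap.sub_apply, LinearMap.smul_apply,
      smul_eq_mul]
    ring

lemma isAlgCurvature_endCurvature (symm : ∀ x y, g x y = g y x) {J : Module.End ℝ V}
    (hJ : ∀ x y, g (J x) y = -g x (J y)) :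
    IsAlgCurvature g (endCurvature g J) where
  antisymm x y z := by
    have : g y (J x) = - g x (J y) := by rw [symm, hJ]
    simp only [endCurvature_apply, this]
    module
  bianchi x y z := by
    have e₁ : g (J y) x = - g y (J x) := hJ _ _
    have e₂ : g (J z) x = - g z (J x) := hJ _ _
    have e₃ : g (J z) y = - g z (J y) := hJ _ _
    have e₄ : g (J x) y = g y (J x) := symm _ _
    have e₅ : g (J x) z = g z (J x) := symm _ _
    have e₆ : g (J y) z = g z (J y) := symm _ _
    have e₇ : g x (J y) = - g y (J x) := by rw [symm, hJ]
    have e₉ : g y (J z) = - g z (J y) := by rw [symm, hJ]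
    simp only [endCurvature_apply, e₁, e₂, e₃, e₄, e₅, e₆, e₇, e₉]
    module
  skew x y z w := by
    simp only [endCurvature_apply, map_sub, map_add, map_smul, LinearMap.sub_apply,
      LinearMap.add_apply, LinearMap.smul_apply, smul_eq_mul]
    rw [hJ z w, symm z (J w)]
    ring

end Algebraic

/-! ### From rank one Jacobi operators to an almost Hermitian structure -/

section Osserman

variable {V : Type*} [AddCommGroup V] [Module ℝ V] {g : V →ₗ[ℝ] V →ₗ[ℝ] ℝ}

lemma eq_zero_of_form_self (pos : ∀ x, x ≠ 0 → 0 < g x x) {v : V} (h : g v v = 0) : v = 0 := by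
  by_contra hv
  exact (pos v hv).ne' h

/-- The equality case of the Cauchy–Schwarz inequality. -/
lemma eq_smul_of_sq_form_eq (symm : ∀ x y, g x y = g y x) (pos : ∀ x, x ≠ 0 → 0 < g x x)
    {x v : V} (hv : v ≠ 0) (h : g x v ^ 2 = g x x * g v v) :
    x = (g x v / g v v) • v := by
  have hvv := (pos v hv).ne'
  refine sub_eq_zero.1 (eq_zero_of_form_self pos ?_)
  simp only [map_sub, map_smul, LinearMap.sub_apply, LinearMap.smul_apply, smul_eq_mul, symm v x]
  field_simp
  linarith

lemma exists_orthogonal_component (pos : ∀ x, x ≠ 0 → 0 < g x x)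
    {u v : V} (hu : u ≠ 0) (hv : ∀ s : ℝ, v ≠ s • u) :
    ∃ (e : V) (k : ℝ), g e u = 0 ∧ 0 < g e e ∧ v = e + k • u := by
  have huu := (pos u hu).ne'
  refine ⟨v - (g v u / g u u) • u, g v u / g u u, ?_, pos _ ?_, by abel⟩
  · simp only [map_sub, map_smul, LinearMap.sub_apply, LinearMap.smul_apply, smul_eq_mul]
    field_simp
    ring
  · exact sub_ne_zero.2 (hv _)

/-- A vector that is orthogonal to everything orthogonal to `u` and `v` lies in their span. -/
lemma exists_eq_smul_add_smul (symm : ∀ x y, g x y = g y x) (pos : ∀ x, x ≠ 0 → 0 < g x x)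
    {u v z : V} (hu : u ≠ 0) (hv : ∀ s : ℝ, v ≠ s • u)
    (h : ∀ y, g y u = 0 → g y v = 0 → g y z = 0) : ∃ α β : ℝ, z = α • u + β • v := by
  obtain ⟨e, k, heu, hee, rfl⟩ := exists_orthogonal_component pos hu hv
  have huu := (pos u hu).ne'
  have hue : g u e = 0 := by rw [symm, heu]
  set y := z - (g z u / g u u) • u - (g z e / g e e) • e with hy
  have hyu : g y u = 0 := by
    simp only [hy, map_sub, map_smul, LinearMap.sub_apply, LinearMap.smul_apply, smul_eq_mul, heu]
    field_simp
    ring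
  have hye : g y e = 0 := by
    simp only [hy, map_sub, map_smul, LinearMap.sub_apply, LinearMap.smul_apply, smul_eq_mul, hue]
    field_simp
    ring
  have hyz : g y z = 0 := h y hyu (by rw [map_add, map_smul, hye, hyu, smul_zero, add_zero])
  have hyy : g y y = 0 := by
    nth_rw 2 [hy]
    rw [map_sub, map_sub, map_smul, map_smul, hyz, hyu, hye]
    simp
  have := eq_zero_of_form_self pos hyy
  refine ⟨g z u / g u u - g z e / g e e * k, g z e / g e e, ?_⟩
  rw [hy, sub_sub, sub_eq_zero] at this
  nth_rw 1 [this]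
  module

lemma exists_dual_pair (symm : ∀ x y, g x y = g y x) (pos : ∀ x, x ≠ 0 → 0 < g x x)
    {u v : V} (hu : u ≠ 0) (hv : ∀ s : ℝ, v ≠ s • u) :
    ∃ a b, g a u = 1 ∧ g a v = 0 ∧ g b u = 0 ∧ g b v = 1 := by
  obtain ⟨e, k, heu, hee, rfl⟩ := exists_orthogonal_component pos hu hv
  have huu := (pos u hu).ne'
  have hue : g u e = 0 := by rw [symm, heu]
  have hee' := hee.ne'
  refine ⟨(g u u)⁻¹ • u - (k * (g e e)⁻¹) • e, (g e e)⁻¹ • e, ?_, ?_, ?_, ?_⟩ <;>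
  · simp only [map_add, map_sub, map_smul, LinearMap.sub_apply, LinearMap.smul_apply, smul_eq_mul,
      heu, hue]
    field_simp
    try ring

variable {G : V →ₗ[ℝ] V →ₗ[ℝ] V →ₗ[ℝ] V} {w : V → V}

/-- Pair symmetry gives `g(y, w(w x))² = g(w x, w y)²`. If `w y` is parallel to `w x`, this is the
equality case of Cauchy–Schwarz for `x` and for `y`, so both are multiples of `w(w x)`. -/
lemma eq_smul_of_eigenvector_eq_smul (symm : ∀ x y, g x y = g y x) (pos : ∀ x, x ≠ 0 → 0 < g x x)
    (hG : IsAlgCurvature g G) (hw₁ : ∀ x, g (w x) (w x) = g x x)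
    (hw : ∀ x y, G y x x = g y (w x) • w x) {x y : V} (hx : x ≠ 0) {s : ℝ} (h : w y = s • w x) :
    ∃ t : ℝ, y = t • x := by
  have hWW := hw₁ x
  have hvv := hw₁ (w x)
  have hxx := pos x hx
  have hv : w (w x) ≠ 0 := fun h0 ↦ by
    rw [h0, map_zero] at hvv
    linarith
  have sec : ∀ y, g y (w (w x)) ^ 2 = g (w x) (w y) ^ 2 := by
    intro y
    have := hG.pair_symm (w x) y y (w x)
    rw [hw, hw, map_smul, map_smul, LinearMap.smul_apply, LinearMap.smul_apply, smul_eq_mul,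
      smul_eq_mul, symm (w y), symm (w (w x))] at this
    linarith
  have ex := eq_smul_of_sq_form_eq symm pos hv (x := x) (by rw [sec, hvv, hWW]; ring)
  have ey := eq_smul_of_sq_form_eq symm pos hv (x := y) (by
    rw [sec, hvv, ← hw₁ y, h]
    simp only [map_smul, LinearMap.smul_apply, smul_eq_mul]
    ring)
  set k := g x (w (w x)) / g (w (w x)) (w (w x))
  set l := g y (w (w x)) / g (w (w x)) (w (w x))
  have hk : k ≠ 0 := by
    intro hk
    rw [hk, zero_smul] at ex
    exact hx ex
  refine ⟨l / k, ?_⟩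
  have : w (w x) = k⁻¹ • x := by rw [eq_inv_smul_iff₀ hk, ← ex]
  rw [ey, this, smul_smul, div_eq_mul_inv]

/-- Polarization of the rank one operators `G(·, x)x`. -/
lemma polar_eigenvector (symm : ∀ x y, g x y = g y x) (pos : ∀ x, x ≠ 0 → 0 < g x x)
    (hw₁ : ∀ x, g (w x) (w x) = g x x) (hw : ∀ x y, G y x x = g y (w x) • w x)
    {x y : V} (hx : x ≠ 0) (h : ∀ s : ℝ, w y ≠ s • w x) :
    ∃ σ : ℝ, σ ^ 2 = 1 ∧ ∀ u, G u x y + G u y x = σ • (g u (w x) • w y + g u (w y) • w x) := by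
  have hwx : w x ≠ 0 := by
    intro h0
    have := hw₁ x
    rw [h0, map_zero] at this
    exact (pos x hx).ne this
  have exp : ∀ (t : ℝ) u, g u (w (x + t • y)) • w (x + t • y)
      = g u (w x) • w x + t • (G u x y + G u y x) + t ^ 2 • (g u (w y) • w y) := by
    intro t u
    rw [← hw, ← hw, ← hw]
    simp only [map_add, map_smul, LinearMap.add_apply, LinearMap.smul_apply]
    module
  have exp' : ∀ (t : ℝ) u v, g u (w (x + t • y)) * g v (w (x + t • y))
      = g u (w x) * g v (w x) + t * g v (G u x y + G u y x) + t ^ 2 * (g u (w y) * g v (w y)) := by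
    intro t u v
    simpa only [map_add, map_smul, smul_eq_mul] using congr(g v $(exp t u))
  -- Adding the expansions for `t = 1` and `t = -1` removes the mixed term: for `u ⊥ w x, w y` the
  -- squares of `g(u, w(x + y))` and `g(u, w(x - y))` sum to zero.
  obtain ⟨α, β, hαβ⟩ := exists_eq_smul_add_smul symm pos hwx h (z := w (x + (1 : ℝ) • y)) (by
    intro u hu hu'
    have h₁ := exp' 1 u u
    have h₂ := exp' (-1) u u
    rw [hu, hu'] at h₁ h₂
    have : g u (w (x + (1 : ℝ) • y)) * g u (w (x + (1 : ℝ) • y)) = 0 := by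
      nlinarith [mul_self_nonneg (g u (w (x + (1 : ℝ) • y))),
        mul_self_nonneg (g u (w (x + (-1 : ℝ) • y)))]
    exact mul_self_eq_zero.1 this)
  have hD : ∀ u, G u x y + G u y x = (α ^ 2 - 1) • (g u (w x) • w x)
      + (α * β) • (g u (w x) • w y + g u (w y) • w x) + (β ^ 2 - 1) • (g u (w y) • w y) := by
    intro u
    have := exp 1 u
    rw [hαβ, one_smul, one_pow, one_smul] at this
    rw [← sub_eq_iff_eq_add, ← sub_eq_iff_eq_add'] at this
    rw [← this]
    simp only [map_add, map_smul, smul_eq_mul]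
    module
  obtain ⟨a, b, a₁, a₂, b₁, b₂⟩ := exists_dual_pair symm pos hwx h
  -- The operator of `x + t y` has rank at most one, so its 2×2 determinant on the dual pair `a, b`
  -- vanishes for every `t`. The values `t = -1` and `t = 2` force `α² = β² = 1`.
  have det : ∀ t : ℝ, (1 + t * (α ^ 2 - 1)) * (t ^ 2 + t * (β ^ 2 - 1)) = t ^ 2 * (α * β) ^ 2 := by
    intro t
    have e₁ := exp' t a a
    have e₂ := exp' t a b
    have e₃ := exp' t b b
    simp only [hD, map_add, map_smul, smul_eq_mul, a₁, a₂, b₁, b₂, mul_zero, mul_one, add_zero,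
      zero_add] at e₁ e₂ e₃
    rw [← e₁, add_comm (t ^ 2), ← e₃, ← mul_pow, ← e₂]
    ring
  have d₁ := det 1
  have d₂ := det (-1)
  have d₃ := det 2
  have hα : α ^ 2 = 1 := by nlinarith
  have hβ : β ^ 2 = 1 := by nlinarith
  refine ⟨α * β, by rw [mul_pow, hα, hβ, one_mul], fun u ↦ ?_⟩
  rw [hD, hα, hβ, sub_self, zero_smul, zero_smul, zero_add, add_zero]

/-- Each `w y` is determined only up to sign. Polarizing against one fixed `x₀` synchronizes the
signs by a formula linear in `y`. The resulting `J` is an isometry with `Jy ⊥ y`, so it is skew and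
`J² = -1`. -/
theorem exists_complex_structure_of_jacobi (symm : ∀ x y, g x y = g y x)
    (pos : ∀ x, x ≠ 0 → 0 < g x x)
    (hG : IsAlgCurvature g G) (hw₁ : ∀ x, g (w x) (w x) = g x x) (hw₂ : ∀ x, g (w x) x = 0)
    (hw : ∀ x y, G y x x = g y (w x) • w x) {x₀ : V} (hx₀ : x₀ ≠ 0) :
    ∃ J : Module.End ℝ V, (∀ x, J (J x) = -x) ∧ (∀ x y, g (J x) (J y) = g x y) ∧
      G = (1 / 3 : ℝ) • endCurvature g J := by
  set N := g x₀ x₀ with hN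
  have hN0 : N ≠ 0 := (pos x₀ hx₀).ne'
  have hw₀ : g (w x₀) (w x₀) = N := hw₁ x₀
  set L : Module.End ℝ V := G (w x₀) x₀ + (G (w x₀)).flip x₀ with hL
  have hLy : ∀ y, L y = G (w x₀) x₀ y + G (w x₀) y x₀ := fun y ↦ rfl
  -- If `w y` is not a multiple of `w x₀`, then `L y = σ (N w y + g(w x₀, w y) w x₀)` and `g(w x₀, L
  -- y) = 2σN g(w x₀, w y)`. The correction removes the `w x₀` term and leaves `J y = σ w y`. The
  -- same formula gives `J x₀ = w x₀`.
  set J : Module.End ℝ V :=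
    N⁻¹ • (L - (2 * N)⁻¹ • (g (w x₀) ∘ₗ L).smulRight (w x₀)) with hJ
  have hJy : ∀ y, J y = N⁻¹ • (L y - (2 * N)⁻¹ • g (w x₀) (L y) • w x₀) := fun y ↦ rfl
  have key : ∀ y, g (J y) (J y) = g y y ∧ g (J y) y = 0 ∧ ∀ u, G u y y = g u (J y) • J y := by
    intro y
    by_cases h : ∃ s : ℝ, w y = s • w x₀
    · obtain ⟨s, hs⟩ := h
      obtain ⟨t, rfl⟩ := eq_smul_of_eigenvector_eq_smul symm pos hG hw₁ hw hx₀ hs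
      have hJt : J (t • x₀) = t • w x₀ := by
        rw [hJy, hLy, map_smul, map_smul, LinearMap.smul_apply, hw, hw₀]
        simp only [map_add, map_smul, smul_eq_mul, hw₀]
        match_scalars
        field_simp
        ring
      rw [hJt]
      refine ⟨?_, ?_, fun u ↦ ?_⟩
      · simp only [map_smul, LinearMap.smul_apply, smul_eq_mul, hw₀, hN]
      · simp only [map_smul, LinearMap.smul_apply, smul_eq_mul, hw₂, mul_zero]
      · simp only [map_smul, LinearMap.smul_apply, hw, smul_eq_mul]
        module
    · push Not at h
      obtain ⟨σ, hσ, hD⟩ := polar_eigenvector symm pos hw₁ hw hx₀ h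
      have hJt : J y = σ • w y := by
        rw [hJy, hLy, hD, hw₀]
        simp only [map_add, map_smul, smul_eq_mul, hw₀]
        match_scalars <;> field_simp
        ring
      rw [hJt]
      refine ⟨?_, ?_, fun u ↦ ?_⟩
      · simp only [map_smul, LinearMap.smul_apply, smul_eq_mul, hw₁]
        linear_combination g y y * hσ
      · simp only [map_smul, LinearMap.smul_apply, smul_eq_mul, hw₂, mul_zero]
      · rw [hw, map_smul, smul_eq_mul, smul_smul]
        congr 1
        linear_combination (-g u (w y)) * hσ
  have iso : ∀ x y, g (J x) (J y) = g x y := by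
    intro x y
    have h := (key (x + y)).1
    simp only [map_add, LinearMap.add_apply, (key x).1, (key y).1, symm y x,
      symm (J y) (J x)] at h
    linarith
  have skew : ∀ x y, g (J x) y = - g x (J y) := by
    intro x y
    have h := (key (x + y)).2.1
    simp only [map_add, LinearMap.add_apply, (key x).2.1, (key y).2.1] at h
    linarith [symm (J y) x]
  have nondeg : ∀ v, (∀ w, g v w = 0) → v = 0 := fun v hv ↦ eq_zero_of_form_self pos (hv v)
  refine ⟨J, fun x ↦ ?_, iso, ?_⟩
  · rw [← add_eq_zero_iff_eq_neg]
    refine nondeg _ fun z ↦ ?_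
    rw [map_add, LinearMap.add_apply, skew, iso]
    ring
  -- The sectional expressions are `g(x, Jy)²` for `G` and `3 g(x, Jy)²` for `endCurvature`, whence
  -- the factor `1/3`.
  · refine hG.eq_of_sectional ((isAlgCurvature_endCurvature symm skew).smul _) nondeg fun x y ↦ ?_
    rw [(key y).2.2]
    simp only [LinearMap.smul_apply, endCurvature_apply, map_smul, map_add, map_sub,
      LinearMap.sub_apply, LinearMap.add_apply, smul_eq_mul, (key y).2.1, skew x y,
      symm (J y) x]
    ring

/-- An algebraic curvature tensor on a Euclidean space all of whose Jacobi operators have the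
form `b (|x|² - x ⊗ x) + (a - b) w ⊗ w` with `a ≠ b`, `w ⊥ x`, `|w| = |x|`, comes from an almost
Hermitian structure. -/
theorem exists_almostHermitian_of_jacobi (symm : ∀ x y, g x y = g y x)
    (pos : ∀ x, x ≠ 0 → 0 < g x x) {F : V →ₗ[ℝ] V →ₗ[ℝ] V →ₗ[ℝ] V} (hF : IsAlgCurvature g F)
    {a b : ℝ} (hab : a ≠ b)
    (h : ∀ x, ∃ w, g w w = g x x ∧ g w x = 0 ∧
      ∀ y, F y x x = b • (g x x • y - g y x • x) + ((a - b) * g y w) • w)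
    {x₀ : V} (hx₀ : x₀ ≠ 0) :
    ∃ J : Module.End ℝ V, (∀ x, J (J x) = -x) ∧ (∀ x y, g (J x) (J y) = g x y) ∧
      F = b • constCurvature g + ((a - b) / 3) • endCurvature g J := by
  choose w hw₁ hw₂ hw using h
  have hab' : a - b ≠ 0 := sub_ne_zero.2 hab
  obtain ⟨J, hJ₁, hJ₂, hJ₃⟩ := exists_complex_structure_of_jacobi symm pos
    (G := (a - b)⁻¹ • (F - b • constCurvature g))
    ((hF.sub ((isAlgCurvature_constCurvature symm).smul b)).smul _) hw₁ hw₂ (by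
      intro x y
      simp only [LinearMap.smul_apply, LinearMap.sub_apply, hw, constCurvature_apply]
      match_scalars <;> field_simp <;> ring) hx₀
  refine ⟨J, hJ₁, hJ₂, ?_⟩
  rw [inv_smul_eq_iff₀ hab', smul_smul, mul_one_div] at hJ₃
  rw [← hJ₃]
  abel

end Osserman

end PhiNullOsserman

end

/-! ### Characteristic polynomials, eigenspaces and pullbacks -/

noncomputable section

namespace PhiNullOsserman

section LinearAlgebra

variable {V : Type*} [AddCommGroup V] [Module ℝ V]

/-- The characteristic polynomial of an operator of rank two with two dual eigenvectors. -/
lemma X_sq_mul_charpoly_of_rank_two [FiniteDimensional ℝ V] {N : Module.End ℝ V} {a₁ a₂ : ℝ}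
    {l₁ l₂ : V →ₗ[ℝ] ℝ} {v₁ v₂ : V} (h₁₁ : l₁ v₁ = 1) (h₁₂ : l₁ v₂ = 0) (h₂₁ : l₂ v₁ = 0)
    (h₂₂ : l₂ v₂ = 1) (hN : ∀ z, N z = (a₁ * l₁ z) • v₁ + (a₂ * l₂ z) • v₂) :
    X ^ 2 * N.charpoly = X ^ finrank ℝ V * ((X - C a₁) * (X - C a₂)) := by
  set b := finBasis ℝ V
  set b' := Pi.basisFun ℝ (Fin 2)
  -- Factor `N = A ∘ B` through `ℝ²`. Then `B ∘ A` is `diag(a₁, a₂)`, and the characteristic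
  -- polynomials of `AB` and `BA` agree up to powers of `X`.
  let A : (Fin 2 → ℝ) →ₗ[ℝ] V :=
    (LinearMap.proj 0).smulRight v₁ + (LinearMap.proj 1).smulRight v₂
  let B : V →ₗ[ℝ] (Fin 2 → ℝ) := LinearMap.pi ![a₁ • l₁, a₂ • l₂]
  have hAB : N = A ∘ₗ B := by
    ext z
    simp [A, B, hN]
  have hBA : LinearMap.toMatrix b' b' (B ∘ₗ A) = Matrix.diagonal ![a₁, a₂] := by
    ext i j
    fin_cases i <;> fin_cases j <;>
      simp [A, B, b', h₁₁, h₁₂, h₂₁, h₂₂]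
  have h := Matrix.charpoly_mul_comm' (LinearMap.toMatrix b' b A) (LinearMap.toMatrix b b' B)
  rw [← LinearMap.toMatrix_comp, ← LinearMap.toMatrix_comp, ← hAB, hBA,
    LinearMap.charpoly_toMatrix, Matrix.charpoly_diagonal, Fin.prod_univ_two] at h
  simpa using h

lemma charpoly_of_rank_two_perturbation [FiniteDimensional ℝ V] {T : Module.End ℝ V} {c a₁ a₂ : ℝ}
    {l₁ l₂ : V →ₗ[ℝ] ℝ} {v₁ v₂ : V} (h₁₁ : l₁ v₁ = 1) (h₁₂ : l₁ v₂ = 0) (h₂₁ : l₂ v₁ = 0)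
    (h₂₂ : l₂ v₂ = 1) (hT : ∀ z, T z = c • z + (a₁ * l₁ z) • v₁ + (a₂ * l₂ z) • v₂) {d : ℕ}
    (hd : finrank ℝ V = d + 2) :
    T.charpoly = (X ^ d * ((X - C a₁) * (X - C a₂))).comp (X - C c) := by
  have h := X_sq_mul_charpoly_of_rank_two (N := T - c • 1) h₁₁ h₁₂ h₂₁ h₂₂ (a₁ := a₁) (a₂ := a₂) (by
    intro z
    simp only [LinearMap.sub_apply, hT, LinearMap.smul_apply, Module.End.one_apply]
    abel)
  rw [hd, pow_add, mul_comm (X ^ d), mul_assoc] at h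
  rw [← mul_left_cancel₀ (pow_ne_zero 2 X_ne_zero) h, LinearMap.charpoly_sub_smul, comp_assoc]
  simp

variable {g : V →ₗ[ℝ] V →ₗ[ℝ] ℝ}

/-- A self-adjoint operator with a one-dimensional and a complementary eigenspace. -/
lemma exists_unit_eigenvector [FiniteDimensional ℝ V] (pos : ∀ x, x ≠ 0 → 0 < g x x)
    {A : Module.End ℝ V} (hA : ∀ x y, g (A x) y = g (A y) x) (symm : ∀ x y, g x y = g y x)
    {c₁ c₂ : ℝ} (hc : c₁ ≠ c₂) {m : ℕ} (hm : finrank ℝ V = 1 + m)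
    (h₁ : finrank ℝ (A.eigenspace c₁) = 1) (h₂ : finrank ℝ (A.eigenspace c₂) = m) :
    ∃ w, g w w = 1 ∧ ∀ y, A y = c₂ • y + ((c₁ - c₂) * g y w) • w := by
  obtain ⟨v, hv0, hv⟩ := finrank_eq_one_iff'.1 h₁
  have hvv : 0 < g v v := pos v (by simpa using hv0)
  have hAv : A v = c₁ • (v : V) := Module.End.mem_eigenspace_iff.1 v.2
  have hs : Real.sqrt (g v v) ≠ 0 := (Real.sqrt_pos.2 hvv).ne'
  set w : V := (Real.sqrt (g v v))⁻¹ • (v : V) with hw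
  have hww : g w w = 1 := by
    simp only [hw, map_smul, LinearMap.smul_apply, smul_eq_mul]
    field_simp
    rw [Real.sq_sqrt hvv.le]
  have hvw : (v : V) = Real.sqrt (g v v) • w := by rw [hw, smul_inv_smul₀ hs]
  have hAw : A w = c₁ • w := by rw [hw, map_smul, hAv, smul_comm]
  clear_value w
  -- The multiplicities add up to the dimension, so the two eigenspaces span; self-adjointness makes
  -- them orthogonal.
  have disj : Disjoint (A.eigenspace c₁) (A.eigenspace c₂) := A.disjoint_genEigenspace hc 1 1
  have top : A.eigenspace c₁ ⊔ A.eigenspace c₂ = ⊤ :=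
    Submodule.eq_top_of_disjoint _ _ (by rw [h₁, h₂, hm]) disj
  refine ⟨w, hww, fun y ↦ ?_⟩
  obtain ⟨y₁, hy₁, y₂, hy₂, rfl⟩ := Submodule.mem_sup.1 (top ▸ Submodule.mem_top : y ∈ _)
  obtain ⟨k, hk⟩ := hv ⟨y₁, hy₁⟩
  have hk' : y₁ = (k * Real.sqrt (g v v)) • w := by
    rw [mul_smul, ← hvw]
    exact (congrArg Subtype.val hk).symm
  have hA₂ : A y₂ = c₂ • y₂ := Module.End.mem_eigenspace_iff.1 hy₂
  have orth : g y₂ w = 0 := by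
    have := hA y₂ w
    rw [hA₂, hAw] at this
    simp only [map_smul, LinearMap.smul_apply, smul_eq_mul] at this
    rw [symm w, ← sub_eq_zero, ← sub_mul] at this
    exact (mul_eq_zero.1 this).resolve_left (sub_ne_zero.2 hc.symm)
  rw [hk', map_add, map_smul, hAw, hA₂]
  simp only [map_add, map_smul, LinearMap.add_apply, LinearMap.smul_apply, hww, orth, smul_eq_mul]
  module

lemma hasEigenvalue_of_rank_one_perturbation [FiniteDimensional ℝ V] (symm : ∀ x y, g x y = g y x)
    {A : Module.End ℝ V}
    {c₁ c₂ : ℝ} (hc : c₁ ≠ c₂) {m : ℕ} (hm0 : 0 < m) (hm : finrank ℝ V = 1 + m) {w : V}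
    (hw : g w w = 1) (hA : ∀ y, A y = c₂ • y + ((c₁ - c₂) * g y w) • w) :
    (∀ c : ℝ, A.HasEigenvalue c ↔ c = c₁ ∨ c = c₂) ∧
      finrank ℝ (A.eigenspace c₁) = 1 ∧ finrank ℝ (A.eigenspace c₂) = m := by
  have hw0 : w ≠ 0 := by rintro rfl; simp at hw
  have e₁ : A.eigenspace c₁ = Submodule.span ℝ {w} := by
    ext y
    rw [Module.End.mem_eigenspace_iff, Submodule.mem_span_singleton, hA]
    constructor
    · intro h
      refine ⟨g y w, ?_⟩
      have : (c₁ - c₂) • (g y w • w - y) = 0 := by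
        rw [← sub_eq_zero] at h
        rw [← h]
        module
      exact sub_eq_zero.1 ((smul_eq_zero.1 this).resolve_left (sub_ne_zero.2 hc))
    · rintro ⟨k, rfl⟩
      simp only [map_smul, LinearMap.smul_apply, hw, smul_eq_mul]
      module
  have e₂ : A.eigenspace c₂ = LinearMap.ker (g w) := by
    ext y
    rw [Module.End.mem_eigenspace_iff, LinearMap.mem_ker, hA, add_eq_left, symm w]
    simp [hw0, sub_ne_zero.2 hc]
  have f₁ : finrank ℝ (A.eigenspace c₁) = 1 := by rw [e₁, finrank_span_singleton hw0]
  have f₂ : finrank ℝ (A.eigenspace c₂) = m := by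
    have hne : g w ≠ 0 := by intro h; rw [h] at hw; simp at hw
    have := Module.Dual.finrank_ker_add_one_of_ne_zero hne
    rw [e₂]
    omega
  refine ⟨fun c ↦ ⟨fun h ↦ ?_, ?_⟩, f₁, f₂⟩
  · obtain ⟨y, hy⟩ := h.exists_hasEigenvector
    have hy' := hy.apply_eq_smul
    by_contra! hcc
    have h1 := congr(g $hy' w)
    rw [hA] at h1 hy'
    simp only [map_add, map_smul, LinearMap.add_apply, LinearMap.smul_apply, hw, smul_eq_mul] at h1
    have h2 : (c₁ - c) * g y w = 0 := by linear_combination h1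
    have h3 := (mul_eq_zero.1 h2).resolve_left (sub_ne_zero.2 hcc.1.symm)
    rw [h3, mul_zero, zero_smul, add_zero, ← sub_eq_zero, ← sub_smul] at hy'
    exact hy.2 ((smul_eq_zero.1 hy').resolve_left (sub_ne_zero.2 hcc.2.symm))
  · have key : ∀ c, 0 < finrank ℝ (A.eigenspace c) → A.HasEigenvalue c := by
      intro c hc h
      have hc' : 0 < finrank ℝ (A.eigenspace c) := hc
      rw [show A.eigenspace c = ⊥ from h, finrank_bot] at hc'
      exact hc'.false
    rintro (rfl | rfl)
    · exact key _ (by rw [f₁]; exact one_pos)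
    · exact key _ (by rw [f₂]; exact hm0)

/-- Pullback of an algebraic curvature tensor along a projection. -/
def pullCurvature {W : Type*} [AddCommGroup W] [Module ℝ W] (pr : V →ₗ[ℝ] W) (ι : W →ₗ[ℝ] V)
    (F : W →ₗ[ℝ] W →ₗ[ℝ] W →ₗ[ℝ] W) : V →ₗ[ℝ] V →ₗ[ℝ] V →ₗ[ℝ] V :=
  LinearMap.mk₂ ℝ (fun x y ↦ ι ∘ₗ F (pr x) (pr y) ∘ₗ pr)
    (fun x x' y ↦ by ext; simp) (fun c x y ↦ by ext; simp)
    (fun x x' y ↦ by ext; simp) (fun c x y ↦ by ext; simp)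

@[simp] lemma pullCurvature_apply {W : Type*} [AddCommGroup W] [Module ℝ W] (pr : V →ₗ[ℝ] W)
    (ι : W →ₗ[ℝ] V) (F : W →ₗ[ℝ] W →ₗ[ℝ] W →ₗ[ℝ] W) (x y z : V) :
    pullCurvature pr ι F x y z = ι (F (pr x) (pr y) (pr z)) := rfl

lemma IsAlgCurvature.pull {W : Type*} [AddCommGroup W] [Module ℝ W] {pr : V →ₗ[ℝ] W}
    {ι : W →ₗ[ℝ] V} {h : W →ₗ[ℝ] W →ₗ[ℝ] ℝ} (hι : ∀ a v, g (ι a) v = h a (pr v))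
    {F : W →ₗ[ℝ] W →ₗ[ℝ] W →ₗ[ℝ] W} (hF : IsAlgCurvature h F) :
    IsAlgCurvature g (pullCurvature pr ι F) where
  antisymm x y z := by simp [hF.antisymm (pr x)]
  bianchi x y z := by simp [← map_add, hF.bianchi]
  skew x y z w := by simp [hι, hF.skew _ _ (pr z)]

/-- A map with the symmetries of a curvature tensor is trilinear. -/
lemma exists_isAlgCurvature {R : V → V → V → V} (nondeg : ∀ v, (∀ w, g v w = 0) → v = 0)
    (h₁ : ∀ x y z, R x y z = -R y x z) (h₂ : ∀ x y z, R x y z + R y z x + R z x y = 0)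
    (h₃ : ∀ x y z w, g (R x y z) w = -g (R x y w) z) :
    ∃ R' : V →ₗ[ℝ] V →ₗ[ℝ] V →ₗ[ℝ] V, (∀ x y z, R' x y z = R x y z) ∧ IsAlgCurvature g R' := by
  have ext : ∀ v v', (∀ w, g v w = g v' w) → v = v' := fun v v' h ↦
    sub_eq_zero.1 (nondeg _ fun w ↦ by rw [map_sub, LinearMap.sub_apply, h, sub_self])
  have pair : ∀ x y z w, g (R x y z) w = g (R z w x) y := by
    refine curvature_pair_symm (fun x y z w ↦ g (R x y z) w) ?_ h₃ ?_
    · intro x y z w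
      simp only [h₁ x y, map_neg, LinearMap.neg_apply]
    · intro x y z w
      simp only [← LinearMap.add_apply, ← map_add]
      rw [h₂, map_zero, LinearMap.zero_apply]
  have pair' : ∀ x y z w, g (R x y z) w = -g (R z w y) x := by
    intro x y z w
    rw [pair, h₃]
  -- Each argument of `R` can be moved by the symmetries into a slot of `g`, which is linear;
  -- nondegeneracy removes the test vector.
  refine ⟨LinearMap.mk₂ ℝ (fun x y ↦ ⟨⟨R x y, fun z z' ↦ ext _ _ fun w ↦ ?_⟩,
    fun c z ↦ ext _ _ fun w ↦ ?_⟩) (fun x x' y ↦ ?_) (fun c x y ↦ ?_) (fun x y y' ↦ ?_)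
    (fun c x y ↦ ?_), fun _ _ _ ↦ rfl, h₁, h₂, h₃⟩
  · rw [map_add, LinearMap.add_apply, h₃, h₃ x y z, h₃ x y z', map_add]; ring
  · rw [map_smul, LinearMap.smul_apply, h₃, h₃ x y z, map_smul]; simp
  · refine LinearMap.ext fun z ↦ ext _ _ fun w ↦ ?_
    change g (R (x + x') y z) w = g (R x y z + R x' y z) w
    rw [map_add, LinearMap.add_apply, pair', pair' x, pair' x', map_add]; ring
  · refine LinearMap.ext fun z ↦ ext _ _ fun w ↦ ?_
    change g (R (c • x) y z) w = g (c • R x y z) w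
    rw [map_smul, LinearMap.smul_apply, pair', pair' x, map_smul]; simp
  · refine LinearMap.ext fun z ↦ ext _ _ fun w ↦ ?_
    change g (R x (y + y') z) w = g (R x y z + R x y' z) w
    rw [map_add, LinearMap.add_apply, pair, pair x y, pair x y', map_add]
  · refine LinearMap.ext fun z ↦ ext _ _ fun w ↦ ?_
    change g (R x (c • y) z) w = g (c • R x y z) w
    rw [map_smul, LinearMap.smul_apply, pair, pair x y, map_smul]

/-- An algebraic curvature tensor is determined by its values on the image of a projection and
by its values on the kernel in the last argument. -/
lemma IsAlgCurvature.eq_of_eq_on {R R' : V →ₗ[ℝ] V →ₗ[ℝ] V →ₗ[ℝ] V} (hR : IsAlgCurvature g R)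
    (hR' : IsAlgCurvature g R') (nondeg : ∀ v, (∀ w, g v w = 0) → v = 0) (P : Module.End ℝ V)
    (h : ∀ x y z, R x y (z - P z) = R' x y (z - P z))
    (h' : ∀ x y z, R (P x) (P y) (P z) = R' (P x) (P y) (P z)) : R = R' := by
  have hT := hR.sub hR'
  -- The difference factors through `P` in the last argument; pair symmetry carries this to the
  -- first and antisymmetry to the second.
  have e₁ : ∀ x y z, (R - R') x y z = (R - R') x y (P z) := by
    intro x y z
    rw [← sub_eq_zero, ← map_sub]
    simp only [LinearMap.sub_apply, h, sub_self]
  have e₂ : ∀ x y z, (R - R') x y z = (R - R') (P x) y z := by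
    intro x y z
    rw [← sub_eq_zero]
    refine nondeg _ fun w ↦ ?_
    rw [map_sub, LinearMap.sub_apply, hT.pair_symm, e₁, hT.pair_symm (P x), sub_self]
  rw [← sub_eq_zero]
  refine LinearMap.ext₂ fun x y ↦ LinearMap.ext fun z ↦ ?_
  rw [e₁, e₂, hT.antisymm, e₂, hT.antisymm, neg_neg, LinearMap.sub_apply, LinearMap.sub_apply,
    LinearMap.sub_apply, h', sub_self]
  rfl

end LinearAlgebra

end PhiNullOsserman

end

/-! ### Jacobi operators of an algebraic curvature tensor -/

noncomputable section

namespace PhiNullOsserman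

section JacobiOperator

variable {V : Type*} [AddCommGroup V] [Module ℝ V] {g : V →ₗ[ℝ] V →ₗ[ℝ] ℝ}
  {F : V →ₗ[ℝ] V →ₗ[ℝ] V →ₗ[ℝ] V}

lemma IsAlgCurvature.self_left (hF : IsAlgCurvature g F) (x y : V) : F x x y = 0 := by
  have h : (2 : ℝ) • F x x y = 0 := by rw [two_smul, ← eq_neg_iff_add_eq_zero, ← hF.antisymm]
  exact (smul_eq_zero.1 h).resolve_left two_ne_zero

lemma IsAlgCurvature.form_self (hF : IsAlgCurvature g F) (x y z : V) : g (F x y z) z = 0 :=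
  self_eq_neg.1 (hF.skew x y z z)

/-- The operator `y ↦ y + F(y, x)x` on the orthogonal complement of `x`. -/
def shiftedJacobi (hF : IsAlgCurvature g F) (symm : ∀ x y, g x y = g y x) (x : V) :
    Module.End ℝ (LinearMap.ker (g x)) :=
  (1 + (F.flip x).flip x : Module.End ℝ V).restrict fun y hy ↦ by
    rw [LinearMap.mem_ker] at hy ⊢
    rw [LinearMap.add_apply, Module.End.one_apply, map_add, hy, zero_add, symm]
    exact hF.form_self y x x

@[simp] lemma coe_shiftedJacobi (hF : IsAlgCurvature g F) (symm : ∀ x y, g x y = g y x) (x : V)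
    (y : LinearMap.ker (g x)) : (shiftedJacobi hF symm x y : V) = y + F y x x := rfl

lemma finrank_ker_form [FiniteDimensional ℝ V] {x : V} (hx : g x x ≠ 0) :
    finrank ℝ (LinearMap.ker (g x)) + 1 = finrank ℝ V :=
  Module.Dual.finrank_ker_add_one_of_ne_zero fun h ↦ hx (by rw [h, LinearMap.zero_apply])

/-- The Jacobi operators of an algebraic curvature tensor whose shifted Jacobi operators have two
eigenvalues, one of which is simple. -/
lemma exists_jacobi_eq [FiniteDimensional ℝ V] (hF : IsAlgCurvature g F)
    (symm : ∀ x y, g x y = g y x) (pos : ∀ x, x ≠ 0 → 0 < g x x) {c₁ c₂ : ℝ} (hc : c₁ ≠ c₂)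
    {m : ℕ} (hm : finrank ℝ V = m + 2)
    (h : ∀ x, g x x = 1 → finrank ℝ ((shiftedJacobi hF symm x).eigenspace c₁) = 1 ∧
      finrank ℝ ((shiftedJacobi hF symm x).eigenspace c₂) = m) (x : V) :
    ∃ w, g w w = g x x ∧ g w x = 0 ∧ ∀ y, F y x x = (c₂ - 1) • (g x x • y - g y x • x)
      + ((c₁ - 1 - (c₂ - 1)) * g y w) • w := by
  -- The shift by the identity turns the eigenvalues `c₁, c₂` into `c₁ - 1, c₂ - 1` for `F`. Vectors
  -- of length `r` follow from unit vectors by replacing `w` with `r w`.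
  have unit : ∀ x, g x x = 1 → ∃ w, g w w = 1 ∧ g w x = 0 ∧
      ∀ y, F y x x = (c₂ - 1) • (y - g y x • x) + ((c₁ - c₂) * g y w) • w := by
    intro x hx
    have hfin := finrank_ker_form (g := g) (x := x) (by rw [hx]; exact one_ne_zero)
    obtain ⟨w, hw, hA⟩ := exists_unit_eigenvector
      (g := g.domRestrict₁₂ (LinearMap.ker (g x)) (LinearMap.ker (g x)))
      (fun y hy ↦ pos y (by simpa using hy)) (A := shiftedJacobi hF symm x)
      (fun y z ↦ by
        simp only [LinearMap.domRestrict₁₂_apply, coe_shiftedJacobi, map_add, LinearMap.add_apply]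
        rw [symm (y : V), hF.pair_symm (y : V), hF.antisymm, hF.skew]
        simp)
      (fun y z ↦ symm y z) hc (m := m) (by omega) (h x hx).1 (h x hx).2
    have hwx : g w x = 0 := by rw [symm]; exact w.2
    refine ⟨w, hw, hwx, fun y ↦ ?_⟩
    have hy : y - g y x • x ∈ LinearMap.ker (g x) := by
      rw [LinearMap.mem_ker, map_sub, map_smul, hx, symm x y]; simp
    have := congrArg Subtype.val (hA ⟨_, hy⟩)
    simp only [coe_shiftedJacobi, Submodule.coe_add, Submodule.coe_smul,
      LinearMap.domRestrict₁₂_apply, map_sub, map_smul, LinearMap.sub_apply, LinearMap.smul_apply,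
      hF.self_left, symm x (w : V), hwx, smul_zero, sub_zero] at this
    rw [sub_smul, one_smul, ← sub_eq_iff_eq_add'.2 this.symm]
    abel
  by_cases hx : x = 0
  · exact ⟨0, by simp [hx]⟩
  have hr : 0 < Real.sqrt (g x x) := Real.sqrt_pos.2 (pos x hx)
  have hr2 : Real.sqrt (g x x) * Real.sqrt (g x x) = g x x := Real.mul_self_sqrt (pos x hx).le
  generalize Real.sqrt (g x x) = r at hr hr2
  obtain ⟨x', rfl⟩ : ∃ x', x = r • x' := ⟨r⁻¹ • x, (smul_inv_smul₀ hr.ne' x).symm⟩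
  simp only [map_smul, LinearMap.smul_apply, smul_eq_mul] at hr2 ⊢
  have hx' : g x' x' = 1 := by
    have : r * r * (g x' x' - 1) = 0 := by linear_combination -hr2
    have := (mul_eq_zero.1 this).resolve_left (mul_pos hr hr).ne'
    linarith
  obtain ⟨w, hw, hwx, hF'⟩ := unit x' hx'
  refine ⟨r • w, ?_, ?_, fun y ↦ ?_⟩
  · simp [hw, hx']
  · simp [hwx]
  · rw [hF', hx']
    simp only [map_smul, smul_eq_mul]
    module

/-- The Jacobi operators of the curvature tensor of a complex space form. -/
lemma jacobi_eq_of_almostHermitian (symm : ∀ x y, g x y = g y x)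
    {J : Module.End ℝ V} (hJ : ∀ x, J (J x) = -x) (hJg : ∀ x y, g (J x) (J y) = g x y) {c₁ c₂ : ℝ}
    (h : F = (c₂ - 1) • constCurvature g + ((c₁ - c₂) / 3) • endCurvature g J) {x : V}
    (hx : g x x = 1) :
    g (J x) (J x) = 1 ∧ g x (J x) = 0 ∧ ∀ y, F y x x = (c₂ - 1) • (y - g y x • x)
      + ((c₁ - c₂) * g y (J x)) • J x := by
  have skew : ∀ x y, g (J x) y = -g x (J y) := by
    intro x y
    rw [← hJg x (J y), hJ, map_neg, neg_neg]
  have hxJ : g x (J x) = 0 := self_eq_neg.1 (by rw [← skew, symm])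
  refine ⟨by rw [hJg, hx], hxJ, fun y ↦ ?_⟩
  rw [h]
  simp only [LinearMap.add_apply, LinearMap.smul_apply, constCurvature_apply, endCurvature_apply,
    skew, hxJ, hx]
  module

lemma finrank_eigenspace_of_semiconj {W : Type*} [AddCommGroup W] [Module ℝ W] (e : V ≃ₗ[ℝ] W)
    {A : Module.End ℝ V} {B : Module.End ℝ W} (h : ∀ y, B (e y) = e (A y)) (c : ℝ) :
    finrank ℝ (B.eigenspace c) = finrank ℝ (A.eigenspace c) ∧
      (B.HasEigenvalue c ↔ A.HasEigenvalue c) := by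
  have he : B.eigenspace c = (A.eigenspace c).map (e : V →ₗ[ℝ] W) := by
    ext w
    obtain ⟨v, rfl⟩ := e.surjective w
    rw [Module.End.mem_eigenspace_iff, h, ← map_smul, e.injective.eq_iff,
      ← Module.End.mem_eigenspace_iff]
    simp
  refine ⟨?_, ?_⟩
  · rw [he]
    exact LinearEquiv.finrank_map_eq e _
  · rw [Module.End.hasEigenvalue_iff, Module.End.hasEigenvalue_iff, he, Ne, Ne,
      Submodule.map_eq_bot_iff]

end JacobiOperator

end PhiNullOsserman

end

/-! ### Splitting the curvature into `S^*` and a tensor on `Im φ` -/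

noncomputable section

namespace PhiNullOsserman

section Metric

variable {E : Type*} [NormedAddCommGroup E] [NormedSpace ℝ E]
  {H : Type*} [TopologicalSpace H] {I : ModelWithCorners ℝ E H}
  {M : Type*} [TopologicalSpace M] [ChartedSpace H M] [IsManifold I ∞ M]

namespace LorentzMetric

variable (g : LorentzMetric I M) {p : M}

/-- In a Lorentz space, the orthogonal complement of a timelike vector is positive definite. -/
lemma pos_of_timelike {a x : TangentSpace I p} (ha : g.form p a a < 0) (hax : g.form p a x = 0)
    (hx : x ≠ 0) : 0 < g.form p x x := by
  obtain ⟨z, hz, hpos⟩ := g.lorentz p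
  have ha0 : a ≠ 0 := by rintro rfl; simp at ha
  have hza : g.form p z a ≠ 0 := fun h ↦ (hpos a h ha0).not_gt ha
  have hxa : g.form p x a = 0 := by rw [g.symm, hax]
  -- This combination is orthogonal to `z`, so its square `g(z,x)² g(a,a) + g(z,a)² g(x,x)` is
  -- positive, although the first term is not.
  have hv0 : g.form p z x • a - g.form p z a • x ≠ 0 := by
    intro h
    have h₁ := congr(g.form p a $h)
    simp only [map_sub, map_smul, smul_eq_mul, hax, mul_zero, sub_zero, map_zero] at h₁
    rw [(mul_eq_zero.1 h₁).resolve_right ha.ne, zero_smul, zero_sub, neg_eq_zero] at h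
    exact (smul_eq_zero.1 h).elim hza hx
  have h := hpos _ (by simp only [map_sub, map_smul, smul_eq_mul]; ring) hv0
  simp only [map_sub, map_smul, sub_apply, smul_apply, smul_eq_mul, hax, hxa] at h
  have h₂ : 0 < g.form p z a ^ 2 * g.form p x x := by
    nlinarith [mul_nonneg (sq_nonneg (g.form p z x)) (neg_pos.2 ha).le]
  exact (pos_iff_pos_of_mul_pos h₂).1 (by positivity)

variable (p) in
/-- The metric at `p` as a bilinear map. -/
def bilin : TangentSpace I p →ₗ[ℝ] TangentSpace I p →ₗ[ℝ] ℝ :=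
  LinearMap.mk₂ ℝ (fun x y ↦ g.form p x y) (by simp) (by simp) (by simp) (by simp)

@[simp] lemma bilin_apply (x y : TangentSpace I p) : g.bilin p x y = g.form p x y := rfl

end LorentzMetric

lemma IsLeviCivita.exists_isAlgCurvature [FiniteDimensional ℝ E] [T2Space M] [Nontrivial E]
    {g : LorentzMetric I M} {cov : CovariantDerivative I E (TangentSpace I : M → Type _)}
    (hcov : IsLeviCivita g cov) (p : M) :
    ∃ R : TangentSpace I p →ₗ[ℝ] TangentSpace I p →ₗ[ℝ] TangentSpace I p →ₗ[ℝ] TangentSpace I p,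
      (∀ x y z, R x y z = curvature cov p x y z) ∧ IsAlgCurvature (g.bilin p) R :=
  PhiNullOsserman.exists_isAlgCurvature (fun _ h ↦ g.eq_zero_of_forall h)
    (curvature_antisymm cov) hcov.curvature_bianchi hcov.curvature_skew

end Metric

namespace LorentzSStructure

variable {E : Type*} [NormedAddCommGroup E] [NormedSpace ℝ E]
  {H : Type*} [TopologicalSpace H] {I : ModelWithCorners ℝ E H}
  {M : Type*} [TopologicalSpace M] [ChartedSpace H M] [IsManifold I ∞ M]

section Image

variable {s : ℕ} (S : LorentzSStructure I M s) {p : M}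

lemma mem_imφ_iff {x : TangentSpace I p} : x ∈ S.imφ p ↔ ∀ α, S.η α p x = 0 := by
  constructor
  · rintro ⟨y, rfl⟩ α
    exact S.η_φ α y
  · intro h
    refine ⟨-S.φ p x, ?_⟩
    change S.φ p (-S.φ p x) = x
    simp [S.φ_sq, h]

@[simp] lemma η_coe (α : Fin s) (x : S.imφ p) : S.η α p x = 0 := S.mem_imφ_iff.1 x.2 α

@[simp] lemma ηtilde_coe (x : S.imφ p) : S.ηtilde p x = 0 := by simp [ηtilde]

lemma coe_projIm (x : TangentSpace I p) :
    (S.projIm p x : TangentSpace I p) = x - ∑ α, S.η α p x • S.ξ α p := by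
  change -S.φ p (S.φ p x) = _
  rw [S.φ_sq]
  abel

lemma φ_φ (x : TangentSpace I p) : S.φ p (S.φ p x) = -(S.projIm p x : TangentSpace I p) :=
  (neg_neg _).symm

@[simp] lemma projIm_coe (x : S.imφ p) : S.projIm p x = x :=
  Subtype.ext (by simp [coe_projIm])

@[simp] lemma projIm_ξ (α : Fin s) : S.projIm p (S.ξ α p) = 0 :=
  Subtype.ext (by simp [coe_projIm, S.η_ξ])

lemma form_coe_ξ (x : S.imφ p) (α : Fin s) : S.g.form p x (S.ξ α p) = 0 := by
  rw [S.g.symm, form_ξ, η_coe, mul_zero]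

lemma form_projIm (x : S.imφ p) (y : TangentSpace I p) :
    S.g.form p x (S.projIm p y) = S.g.form p x y := by
  simp [coe_projIm, form_coe_ξ]

lemma form_φ_φ (x y : TangentSpace I p) :
    S.g.form p (S.φ p x) (S.φ p y) = S.g.form p (S.projIm p x) (S.projIm p y) := by
  rw [form_φ, φ_φ, map_neg, neg_neg, S.g.symm, ← form_projIm, S.g.symm]

variable (p) in
/-- The restriction of the metric to `Im φ`. -/
def formIm : S.imφ p →ₗ[ℝ] S.imφ p →ₗ[ℝ] ℝ := (S.g.bilin p).domRestrict₁₂ _ _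

@[simp] lemma formIm_apply (x y : S.imφ p) : S.formIm p x y = S.g.form p x y := rfl

lemma formIm_symm (x y : S.imφ p) : S.formIm p x y = S.formIm p y x := S.g.symm p x y

lemma R0_eq (x y v : TangentSpace I p) :
    S.R0 p x y v = constCurvature (S.formIm p) (S.projIm p x) (S.projIm p y) (S.projIm p v) := rfl

lemma RJ_eq (J : Module.End ℝ (S.imφ p)) (x y v : TangentSpace I p) :
    S.RJ J x y v
      = endCurvature (S.formIm p) J (S.projIm p x) (S.projIm p y) (S.projIm p v) := rfl

/-- Because `φ² = -π^I`. Thus `-S_* + c₂ R^0` is `(c₂ - 1) R^0`. -/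
lemma lowerS_eq (x y v : TangentSpace I p) : S.lowerS p x y v = S.R0 p x y v := by
  rw [lowerS, R0, φ_φ, φ_φ, form_φ_φ, form_φ_φ]
  module

end Image

section Two

variable (S : LorentzSStructure I M 2) {p : M}

lemma ε_zero (hξ : S.g.form p (S.ξ 0 p) (S.ξ 0 p) < 0) : S.ε 0 = -1 := by
  rcases S.causal 0 with ⟨-, h⟩ | ⟨h, -⟩
  · exact absurd hξ (h p).not_gt
  · exact h

/-- The vector `ξ_2` is orthogonal to the timelike `ξ_1`, hence spacelike by the Lorentz signature.
-/
lemma ε_one (hξ : S.g.form p (S.ξ 0 p) (S.ξ 0 p) < 0) : S.ε 1 = 1 := by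
  have h0 : S.ξ 1 p ≠ 0 := by
    intro h
    have := S.η_ξ 1 1 p
    simp [h] at this
  have h1 := S.g.pos_of_timelike hξ (by rw [form_ξ, S.η_ξ]; simp) h0
  rcases S.causal 1 with ⟨h, -⟩ | ⟨-, h⟩
  · exact h
  · exact absurd (h p) h1.not_gt

lemma formIm_pos (hξ : S.g.form p (S.ξ 0 p) (S.ξ 0 p) < 0) (x : S.imφ p) (hx : x ≠ 0) :
    0 < S.formIm p x x :=
  S.g.pos_of_timelike hξ ((S.g.symm p _ _).trans (S.form_coe_ξ x 0)) (by simpa using hx)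

/-- The same right-hand side as in `curvature_ξ`: `R - S^*` vanishes as soon as an argument lies in
`ker φ`. -/
lemma upperS_ξ (hξ : S.g.form p (S.ξ 0 p) (S.ξ 0 p) < 0) (α : Fin 2)
    (x y : TangentSpace I p) :
    S.upperS p x y (S.ξ α p) = S.ε α • (S.ηtilde p x • S.φ p (S.φ p y)
      - S.ηtilde p y • S.φ p (S.φ p x)) := by
  have e0 := S.ε_zero hξ
  have e1 := S.ε_one hξ
  rw [upperS, S.g.symm p y, S.g.symm p x, form_ξ, form_ξ, S.φ_sq, S.φ_sq]
  fin_cases α <;> simp [ηtilde, ξtilde, e0, e1, S.η_ξ, Fin.sum_univ_two] <;> module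

lemma exists_isAlgCurvature_upperS :
    ∃ U : TangentSpace I p →ₗ[ℝ] TangentSpace I p →ₗ[ℝ] TangentSpace I p →ₗ[ℝ] TangentSpace I p,
      (∀ x y z, U x y z = S.upperS p x y z) ∧ IsAlgCurvature (S.g.bilin p) U := by
  refine PhiNullOsserman.exists_isAlgCurvature (fun _ h ↦ S.g.eq_zero_of_forall h) ?_ ?_ ?_
  · intro x y z
    simp only [upperS]
    abel
  · intro x y z
    simp only [upperS, S.g.symm p z y, S.g.symm p z x, S.g.symm p y x]
    module
  · intro x y z w
    simp only [upperS, LorentzMetric.bilin_apply, map_add, map_sub, map_smul,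
      LinearMap.add_apply, LinearMap.sub_apply, LinearMap.smul_apply, smul_eq_mul, form_ξtilde]
    ring

variable {S} {cov : CovariantDerivative I E (TangentSpace I : M → Type _)}
  [FiniteDimensional ℝ E] [T2Space M] [Nontrivial E]

/-- The curvature tensor is determined by its restriction to `Im φ`. -/
lemma exists_curvature_eq (hcov : IsLeviCivita S.g cov)
    (hξ : S.g.form p (S.ξ 0 p) (S.ξ 0 p) < 0) :
    ∃ F : S.imφ p →ₗ[ℝ] S.imφ p →ₗ[ℝ] S.imφ p →ₗ[ℝ] S.imφ p, IsAlgCurvature (S.formIm p) F ∧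
      ∀ x y v, curvature cov p x y v
        = S.upperS p x y v + F (S.projIm p x) (S.projIm p y) (S.projIm p v) := by
  obtain ⟨R, hR, hRalg⟩ := hcov.exists_isAlgCurvature p
  obtain ⟨U, hU, hUalg⟩ := S.exists_isAlgCurvature_upperS (p := p)
  set F := pullCurvature (S.imφ p).subtype (S.projIm p) R
  have hF : IsAlgCurvature (S.formIm p) F := hRalg.pull fun a v ↦ by
    rw [formIm_symm]
    exact (S.form_projIm v a).trans (S.g.symm p _ _)
  have hF' : IsAlgCurvature (S.g.bilin p) (pullCurvature (S.projIm p) (S.imφ p).subtype F) :=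
    hF.pull fun a v ↦ (S.form_projIm a v).symm
  -- The `ξ_α` component is `-g(R(x, y)ξ_α, z)` up to sign, and `R(x, y)ξ_α` carries a factor `η̃`,
  -- which vanishes on `Im φ`.
  have hRim : ∀ x y z : S.imφ p, R x y z ∈ S.imφ p := by
    intro x y z
    rw [mem_imφ_iff]
    intro α
    have h := hRalg.skew x y z (S.ξ α p)
    rw [hR x y (S.ξ α p), curvature_ξ hcov] at h
    rw [S.η_eq, S.g.symm, mul_eq_zero]
    right
    simpa using h
  refine ⟨F, hF, fun x y v ↦ ?_⟩
  have key : R - pullCurvature (S.projIm p) (S.imφ p).subtype F = U := by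
    refine (hRalg.sub hF').eq_of_eq_on hUalg (fun _ h ↦ S.g.eq_zero_of_forall h)
      ((S.imφ p).subtype ∘ₗ S.projIm p) ?_ ?_
    · intro x y z
      have : z - ((S.imφ p).subtype ∘ₗ S.projIm p) z = ∑ α, S.η α p z • S.ξ α p := by
        simp [coe_projIm]
      have h : ∀ α, R x y (S.ξ α p) = U x y (S.ξ α p) := fun α ↦ by
        rw [hR, hU, curvature_ξ hcov, S.upperS_ξ hξ]
      rw [this]
      simp [h]
    · intro x y z
      have h := S.projIm_coe ⟨_, hRim (S.projIm p x) (S.projIm p y) (S.projIm p z)⟩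
      have h' := congrArg Subtype.val h
      simp only [LinearMap.sub_apply, pullCurvature_apply, LinearMap.comp_apply,
        Submodule.subtype_apply, projIm_coe, F, hU, upperS, ηtilde_coe] at h' ⊢
      rw [h']
      simp
  rw [← hR, ← hU, ← key]
  simp

end Two

end LorentzSStructure

end PhiNullOsserman

end

/-! ### Conditions (b) and (c) in terms of `F`; the quotient `u^⊥ / span{u}` -/

noncomputable section

namespace PhiNullOsserman

namespace LorentzSStructure

variable {E : Type*} [NormedAddCommGroup E] [NormedSpace ℝ E]
  {H : Type*} [TopologicalSpace H] {I : ModelWithCorners ℝ E H}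
  {M : Type*} [TopologicalSpace M] [ChartedSpace H M] [IsManifold I ∞ M]
  {S : LorentzSStructure I M 2} {cov : CovariantDerivative I E (TangentSpace I : M → Type _)}
  {p : M} {F : S.imφ p →ₗ[ℝ] S.imφ p →ₗ[ℝ] S.imφ p →ₗ[ℝ] S.imφ p}
  {J : Module.End ℝ (S.imφ p)} {c₁ c₂ : ℝ}

section Conditions

lemma mem_perp_ξ_zero_iff {x : TangentSpace I p} :
    x ∈ S.g.perp (S.ξ 0 p) ↔ S.η 0 p x = 0 := by
  change S.g.form p (S.ξ 0 p) x = 0 ↔ _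
  rw [form_ξ, mul_eq_zero, or_iff_right]
  intro h
  simpa [h] using S.ε_mul_self 0

lemma coe_mem_perp_ξ (x : S.imφ p) : (x : TangentSpace I p) ∈ S.g.perp (S.ξ 0 p) :=
  mem_perp_ξ_zero_iff.2 (S.η_coe 0 x)

/-- The combination of `R^0` and `R^J` on `Im φ`. -/
lemma coe_formula (x y v : TangentSpace I p) :
    (((c₂ - 1) • constCurvature (S.formIm p) + ((c₁ - c₂) / 3) • endCurvature (S.formIm p) J)
      (S.projIm p x) (S.projIm p y) (S.projIm p v) : TangentSpace I p)
      = -S.lowerS p x y v + c₂ • S.R0 p x y v + ((c₁ - c₂) / 3) • S.RJ J x y v := by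
  rw [lowerS_eq, R0_eq, RJ_eq]
  simp only [LinearMap.add_apply, LinearMap.smul_apply, Submodule.coe_add, Submodule.coe_smul]
  module

lemma eq_iff_forall_projIm {G : S.imφ p →ₗ[ℝ] S.imφ p →ₗ[ℝ] S.imφ p →ₗ[ℝ] S.imφ p} :
    F = G ↔ ∀ x y v : TangentSpace I p, (F (S.projIm p x) (S.projIm p y) (S.projIm p v) :
      TangentSpace I p) = G (S.projIm p x) (S.projIm p y) (S.projIm p v) := by
  refine ⟨by rintro rfl _ _ _; rfl, fun h ↦ LinearMap.ext₂ fun x y ↦ LinearMap.ext fun v ↦ ?_⟩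
  have := h x y v
  simpa using this

lemma conditionB_iff (hF : ∀ x y v, curvature cov p x y v
      = S.upperS p x y v + F (S.projIm p x) (S.projIm p y) (S.projIm p v)) :
    S.ConditionB cov J c₁ c₂ ↔
      F = (c₂ - 1) • constCurvature (S.formIm p)
        + ((c₁ - c₂) / 3) • endCurvature (S.formIm p) J := by
  rw [eq_iff_forall_projIm, ConditionB]
  refine forall₃_congr fun x y v ↦ ?_
  rw [coe_formula, hF, sub_eq_add_neg, add_assoc, add_assoc, add_right_inj, add_assoc]

/-- On `ξ_1^⊥` one has `η̃ = η^2`, so the formula is that of (b). Restricting it to `ξ_1^⊥` loses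
nothing, since `F` lives on `Im φ ⊆ ξ_1^⊥`. -/
lemma conditionC₂_iff (hξ : S.g.form p (S.ξ 0 p) (S.ξ 0 p) < 0) (hF : ∀ x y v, curvature cov p x y v
      = S.upperS p x y v + F (S.projIm p x) (S.projIm p y) (S.projIm p v)) :
    S.ConditionC₂ cov J c₁ c₂ ↔
      F = (c₂ - 1) • constCurvature (S.formIm p)
        + ((c₁ - c₂) / 3) • endCurvature (S.formIm p) J := by
  have key : ∀ x ∈ S.g.perp (S.ξ 0 p), ∀ y ∈ S.g.perp (S.ξ 0 p), ∀ v ∈ S.g.perp (S.ξ 0 p),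
      (curvature cov p x y v = S.η 1 p v • (S.η 1 p y • x - S.η 1 p x • y)
        + (S.g.form p y v * S.η 1 p x - S.g.form p x v * S.η 1 p y) • S.ξtilde p
        + S.g.form p (S.φ p y) (S.φ p v) • S.φ p (S.φ p x)
        - S.g.form p (S.φ p x) (S.φ p v) • S.φ p (S.φ p y)
        + c₂ • S.R0 p x y v + ((c₁ - c₂) / 3) • S.RJ J x y v ↔
      (F (S.projIm p x) (S.projIm p y) (S.projIm p v) : TangentSpace I p)
        = ((c₂ - 1) • constCurvature (S.formIm p) + ((c₁ - c₂) / 3) • endCurvature (S.formIm p) J)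
          (S.projIm p x) (S.projIm p y) (S.projIm p v)) := by
    intro x hx y hy v hv
    have e : ∀ z ∈ S.g.perp (S.ξ 0 p), S.ηtilde p z = S.η 1 p z := by
      intro z hz
      rw [ηtilde, Fin.sum_univ_two, mem_perp_ξ_zero_iff.1 hz, S.ε_one hξ]
      ring
    rw [coe_formula, hF,
      ← add_right_inj (a := S.upperS p x y v) (b := (F _ _ _ : TangentSpace I p))]
    refine Eq.congr_right ?_
    rw [upperS, lowerS, e x hx, e y hy, e v hv]
    module
  rw [eq_iff_forall_projIm]
  constructor
  · intro h x y v
    have := (key _ (coe_mem_perp_ξ (S.projIm p x)) _ (coe_mem_perp_ξ (S.projIm p y)) _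
      (coe_mem_perp_ξ (S.projIm p v))).1
      (h _ (coe_mem_perp_ξ _) _ (coe_mem_perp_ξ _) _ (coe_mem_perp_ξ _))
    simpa only [projIm_coe] using this
  · exact fun h x hx y hy v hv ↦ (key x hx y hy v hv).2 (h x y v)

/-- A case of `curvature_ξ`, so this clause of (c) imposes no condition. -/
lemma conditionC₁ [FiniteDimensional ℝ E] [T2Space M] [Nontrivial E]
    (hcov : IsLeviCivita S.g cov) (hξ : S.g.form p (S.ξ 0 p) (S.ξ 0 p) < 0) :
    S.ConditionC₁ cov p := by
  intro v hv x hx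
  obtain ⟨k, rfl⟩ := Submodule.mem_span_singleton.1 hv
  obtain ⟨R, hR, -⟩ := hcov.exists_isAlgCurvature p
  have h := curvature_ξ hcov 0 x (S.ξ 0 p)
  rw [← hR, map_smul, map_smul, LinearMap.smul_apply, hR, h, S.φ_ξ, S.φ_sq]
  simp only [ηtilde, Fin.sum_univ_two, S.η_ξ, mem_perp_ξ_zero_iff.1 hx, S.ε_zero hξ, S.ε_one hξ,
    map_smul, map_zero, if_true, smul_eq_mul, one_ne_zero, if_false]
  module

end Conditions

section Jacobi

lemma finrank_imφ [FiniteDimensional ℝ E] {n : ℕ} (hE : finrank ℝ E = n + 2) :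
    finrank ℝ (S.imφ p) = n := by
  have : FiniteDimensional ℝ (TangentSpace I p) := inferInstanceAs (FiniteDimensional ℝ E)
  have h := LinearMap.finrank_range_add_finrank_ker
    (S.φ p : TangentSpace I p →ₗ[ℝ] TangentSpace I p)
  have hli : LinearIndependent ℝ (fun α ↦ S.ξ α p) := by
    rw [Fintype.linearIndependent_iff]
    intro c hc α
    have := congr(S.η α p $hc)
    simpa only [map_sum, map_smul, S.η_ξ, smul_eq_mul, mul_ite, mul_one, mul_zero,
      Finset.sum_ite_eq, Finset.mem_univ, if_true, map_zero] using this
  rw [S.ker_φ, finrank_span_eq_card hli, Fintype.card_fin,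
    show finrank ℝ (TangentSpace I p) = n + 2 from hE] at h
  exact Nat.add_right_cancel h

lemma exists_null_eq {u : TangentSpace I p} :
    u ∈ S.nullCongruenceφ p 0 ↔ ∃ x : S.imφ p, S.formIm p x x = 1 ∧ u = S.ξ 0 p + x := by
  constructor
  · rintro ⟨x, ⟨⟨-, h⟩, hx⟩, rfl⟩
    exact ⟨⟨x, hx⟩, h, rfl⟩
  · rintro ⟨x, h, rfl⟩
    exact ⟨x, ⟨⟨coe_mem_perp_ξ x, h⟩, x.2⟩, rfl⟩

lemma mem_span_submoduleOf_iff {u : TangentSpace I p} {y : S.g.perp u} :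
    y ∈ (Submodule.span ℝ {u}).submoduleOf (S.g.perp u) ↔ ∃ k : ℝ, k • u = y :=
  Submodule.mem_span_singleton

/-- The linear form `g(·, w)` on `u^⊥ / span{u}`, for `w ∈ u^⊥`. -/
def barForm {u w : TangentSpace I p} (hw : S.g.form p u w = 0) : S.g.BarPerp u →ₗ[ℝ] ℝ :=
  Submodule.liftQ _ ((S.g.bilin p).flip w ∘ₗ (S.g.perp u).subtype) (by
    intro y hy
    obtain ⟨k, hk⟩ := mem_span_submoduleOf_iff.1 hy
    change S.g.form p (y : TangentSpace I p) w = 0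
    rw [← hk, map_smul, smul_apply, hw, smul_zero])

lemma barForm_toBar {u w : TangentSpace I p} (hw : S.g.form p u w = 0) (y : S.g.perp u) :
    barForm hw (S.g.toBar u y) = S.g.form p y w := rfl

lemma toBar_eq_of_sub_eq_smul {u : TangentSpace I p} {y z : S.g.perp u} {k : ℝ}
    (h : (y : TangentSpace I p) - z = k • u) : S.g.toBar u y = S.g.toBar u z :=
  (Submodule.Quotient.eq _).2 <| mem_span_submoduleOf_iff.2 ⟨k, h.symm⟩

variable {x : S.imφ p}

lemma form_null_self (hξ : S.g.form p (S.ξ 0 p) (S.ξ 0 p) < 0) (hx : S.formIm p x x = 1) :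
    S.g.form p (S.ξ 0 p + x) (S.ξ 0 p + x) = 0 := by
  have h : S.g.form p (x : TangentSpace I p) x = 1 := hx
  simp [form_ξ, form_coe_ξ, h, S.η_ξ, S.ε_zero hξ]

lemma finrank_barPerp [FiniteDimensional ℝ E] {n : ℕ} (hE : finrank ℝ E = n + 2)
    (hξ : S.g.form p (S.ξ 0 p) (S.ξ 0 p) < 0) (hx : S.formIm p x x = 1) :
    finrank ℝ (S.g.BarPerp (S.ξ 0 p + (x : TangentSpace I p))) = n := by
  have : FiniteDimensional ℝ (TangentSpace I p) := inferInstanceAs (FiniteDimensional ℝ E)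
  set u := S.ξ 0 p + (x : TangentSpace I p) with hu
  have hu0 : u ≠ 0 := by
    intro h
    have := congr(S.η 0 p $h)
    simp [hu, S.η_ξ] at this
  have h₁ : finrank ℝ (S.g.perp u) + 1 = n + 2 := by
    rw [← hE]
    refine Module.Dual.finrank_ker_add_one_of_ne_zero (V₁ := TangentSpace I p)
      (f := (S.g.form p u : TangentSpace I p →ₗ[ℝ] ℝ)) fun h ↦ hu0 ?_
    exact S.g.eq_zero_of_forall fun w ↦ LinearMap.congr_fun h w
  have h₂ := Submodule.finrank_quotient_add_finrank
    ((Submodule.span ℝ {u}).submoduleOf (S.g.perp u))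
  have h₃ : Submodule.span ℝ {u} ≤ S.g.perp u := by
    rw [Submodule.span_singleton_le_iff_mem]
    exact form_null_self hξ hx
  rw [(Submodule.submoduleOfEquivOfLe h₃).finrank_eq, finrank_span_singleton hu0] at h₂
  exact Nat.add_right_cancel (h₂.trans (Nat.add_right_cancel h₁))

/-- As `η̃(u) = -1` and `u` is null, `S^*(y, u)u` equals `y` modulo `u`. This is the source of the
identity summand in `shiftedJacobi`. -/
lemma curvature_null (hξ : S.g.form p (S.ξ 0 p) (S.ξ 0 p) < 0) (hx : S.formIm p x x = 1)
    (hF : ∀ x y v, curvature cov p x y v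
      = S.upperS p x y v + F (S.projIm p x) (S.projIm p y) (S.projIm p v))
    {y : TangentSpace I p} (hy : y ∈ S.g.perp (S.ξ 0 p + (x : TangentSpace I p))) :
    curvature cov p y (S.ξ 0 p + x) (S.ξ 0 p + x)
      = y + S.ηtilde p y • (S.ξ 0 p + x) + F (S.projIm p y) x x := by
  have h₁ : S.g.form p y (S.ξ 0 p + x) = 0 := by
    rw [S.g.symm]
    exact hy
  have h₂ : S.ηtilde p (S.ξ 0 p + x) = -1 := by
    simp [ηtilde, S.η_ξ, S.ε_zero hξ]
  have h₃ : S.projIm p (S.ξ 0 p + x) = x := by simp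
  rw [hF, h₃, upperS, h₁, h₂, form_null_self hξ hx]
  module

/-- `Im φ ∩ u^⊥` is the orthogonal complement of `x` in `Im φ` for `u = ξ_1 + x`. -/
def toBarIm (x : S.imφ p) :
    LinearMap.ker (S.formIm p x) →ₗ[ℝ] S.barIm (S.ξ 0 p + (x : TangentSpace I p)) where
  toFun y := ⟨S.g.toBar _ ⟨((y : S.imφ p) : TangentSpace I p), by
      have h : S.g.form p x (y : S.imφ p) = 0 := y.2
      change S.g.form p (S.ξ 0 p + x) (y : S.imφ p) = 0
      rw [map_add, add_apply, h, S.g.symm, form_coe_ξ, add_zero]⟩,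
    Submodule.mem_map_of_mem (y : S.imφ p).2⟩
  map_add' _ _ := rfl
  map_smul' _ _ := rfl

lemma toBarIm_bijective (x : S.imφ p) : Function.Bijective (toBarIm x) := by
  constructor
  · rw [← LinearMap.ker_eq_bot, LinearMap.ker_eq_bot']
    intro y hy
    have h := (Submodule.Quotient.mk_eq_zero _).1 (congrArg Subtype.val hy)
    obtain ⟨k, hk⟩ := mem_span_submoduleOf_iff.1 h
    -- Since `η^1(u) = 1` and `η^1` vanishes on `Im φ`, only the zero multiple of `u` lies in `Im
    -- φ`.
    have hk' : k = 0 := by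
      have := congr(S.η 0 p $hk)
      simpa [S.η_ξ] using this
    rw [hk', zero_smul] at hk
    exact Subtype.ext (Subtype.ext hk.symm)
  · rintro ⟨-, ⟨y, hyu⟩, hy, rfl⟩
    have hy' : y ∈ S.imφ p := hy
    refine ⟨⟨⟨y, hy'⟩, ?_⟩, rfl⟩
    have h : S.g.form p (S.ξ 0 p + x) y = 0 := hyu
    rw [map_add, add_apply, form_ξ, S.mem_imφ_iff.1 hy', mul_zero, zero_add] at h
    exact h

/-- The operator descends to the quotient because `g(R(y, u)u, u) = 0` and `R(u, u)u = 0`. -/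
lemma exists_isJacobiOperator [FiniteDimensional ℝ E] [T2Space M] [Nontrivial E]
    (hcov : IsLeviCivita S.g cov)
    (u : TangentSpace I p) :
    ∃ T : Module.End ℝ (S.g.BarPerp u), S.g.IsJacobiOperator cov u T := by
  obtain ⟨R, hR, hRalg⟩ := hcov.exists_isAlgCurvature p
  have hmem : ∀ y, R y u u ∈ S.g.perp u := fun y ↦
    (S.g.symm p _ _).trans (hRalg.form_self y u u)
  refine ⟨Submodule.mapQ _ _ (((R.flip u).flip u).restrict (p := S.g.perp u) (q := S.g.perp u)
    fun y _ ↦ hmem y) ?_, fun y ↦ ⟨by rw [← hR]; exact hmem y, ?_⟩⟩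
  · intro y hy
    obtain ⟨k, hk⟩ := mem_span_submoduleOf_iff.1 hy
    rw [Submodule.mem_comap, mem_span_submoduleOf_iff]
    refine ⟨0, ?_⟩
    change (0 : ℝ) • u = R (y : TangentSpace I p) u u
    rw [← hk, map_smul, LinearMap.smul_apply, LinearMap.smul_apply, hRalg.self_left, smul_zero,
      zero_smul]
  · simp only [← hR]
    rfl

end Jacobi

end LorentzSStructure

end PhiNullOsserman

end

/-! ### The Osserman condition in terms of `F` and the equivalence -/

noncomputable section

namespace PhiNullOsserman

namespace LorentzSStructure

variable {E : Type*} [NormedAddCommGroup E] [NormedSpace ℝ E]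
  {H : Type*} [TopologicalSpace H] {I : ModelWithCorners ℝ E H}
  {M : Type*} [TopologicalSpace M] [ChartedSpace H M] [IsManifold I ∞ M]
  {S : LorentzSStructure I M 2} {cov : CovariantDerivative I E (TangentSpace I : M → Type _)}
  {p : M} {F : S.imφ p →ₗ[ℝ] S.imφ p →ₗ[ℝ] S.imφ p →ₗ[ℝ] S.imφ p}
  {J : Module.End ℝ (S.imφ p)} {c₁ c₂ : ℝ} {x : S.imφ p} {n : ℕ}

/-- On `Im φ` the factor `η̃(y)` vanishes, so the `u` component in `curvature_null` disappears. -/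
lemma jacobiOperator_toBarIm (hξ : S.g.form p (S.ξ 0 p) (S.ξ 0 p) < 0)
    (hFalg : IsAlgCurvature (S.formIm p) F)
    (hF : ∀ x y v, curvature cov p x y v
      = S.upperS p x y v + F (S.projIm p x) (S.projIm p y) (S.projIm p v))
    (hx : S.formIm p x x = 1) {T : Module.End ℝ (S.g.BarPerp (S.ξ 0 p + (x : TangentSpace I p)))}
    (hT : S.g.IsJacobiOperator cov (S.ξ 0 p + (x : TangentSpace I p)) T)
    (y : LinearMap.ker (S.formIm p x)) :
    T (toBarIm x y) = toBarIm x (shiftedJacobi hFalg S.formIm_symm x y) := by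
  obtain ⟨h, hTy⟩ := hT ⟨((y : S.imφ p) : TangentSpace I p), by
    have h : S.g.form p x (y : S.imφ p) = 0 := y.2
    change S.g.form p (S.ξ 0 p + x) (y : S.imφ p) = 0
    rw [map_add, add_apply, h, S.g.symm, form_coe_ξ, add_zero]⟩
  refine hTy.trans (congrArg _ (Subtype.ext ?_))
  refine (curvature_null hξ hx hF (Subtype.prop _)).trans ?_
  simp

variable [FiniteDimensional ℝ E]

lemma jacobiHasEigenvalues_iff [T2Space M] [Nontrivial E] (hcov : IsLeviCivita S.g cov)
    (hξ : S.g.form p (S.ξ 0 p) (S.ξ 0 p) < 0) (hFalg : IsAlgCurvature (S.formIm p) F)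
    (hF : ∀ x y v, curvature cov p x y v
      = S.upperS p x y v + F (S.projIm p x) (S.projIm p y) (S.projIm p v))
    (hx : S.formIm p x x = 1) {m₁ m₂ : ℕ} :
    S.JacobiHasEigenvalues cov (S.ξ 0 p + (x : TangentSpace I p)) c₁ c₂ m₁ m₂ ↔
      (∀ c, (shiftedJacobi hFalg S.formIm_symm x).HasEigenvalue c ↔ c = c₁ ∨ c = c₂) ∧
      finrank ℝ ((shiftedJacobi hFalg S.formIm_symm x).eigenspace c₁) = m₁ ∧
      finrank ℝ ((shiftedJacobi hFalg S.formIm_symm x).eigenspace c₂) = m₂ := by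
  let e := LinearEquiv.ofBijective (toBarIm x) (toBarIm_bijective x)
  have key := fun (T : Module.End ℝ (S.g.BarPerp (S.ξ 0 p + (x : TangentSpace I p)))) hT
      (h : ∀ w ∈ S.barIm (S.ξ 0 p + (x : TangentSpace I p)), T w ∈ S.barIm _) ↦
    finrank_eigenspace_of_semiconj e (A := shiftedJacobi hFalg S.formIm_symm x)
      (B := T.restrict h) fun y ↦ Subtype.ext (jacobiOperator_toBarIm hξ hFalg hF hx hT y)
  constructor
  · rintro ⟨T, hT, h, h₁, h₂, h₃⟩
    simp only [(key T hT h _).1, (key T hT h _).2] at h₁ h₂ h₃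
    exact ⟨h₁, h₂, h₃⟩
  · rintro ⟨h₁, h₂, h₃⟩
    obtain ⟨T, hT⟩ := exists_isJacobiOperator hcov (S.ξ 0 p + (x : TangentSpace I p))
    have h : ∀ w ∈ S.barIm (S.ξ 0 p + (x : TangentSpace I p)), T w ∈ S.barIm _ := by
      intro w hw
      obtain ⟨y, hy⟩ := (toBarIm_bijective x).2 ⟨w, hw⟩
      rw [← show (toBarIm x y : S.g.BarPerp _) = w from congrArg Subtype.val hy,
        jacobiOperator_toBarIm hξ hFalg hF hx hT y]
      exact Subtype.prop _
    refine ⟨T, hT, h, ?_⟩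
    simp only [(key T hT h _).1, (key T hT h _).2]
    exact ⟨h₁, h₂, h₃⟩

/-- The characteristic polynomial of the Jacobi operator when the curvature of `Im φ` is that of a
complex space form. -/
lemma charpoly_jacobiOperator (hξ : S.g.form p (S.ξ 0 p) (S.ξ 0 p) < 0)
    (hF : ∀ x y v, curvature cov p x y v
      = S.upperS p x y v + F (S.projIm p x) (S.projIm p y) (S.projIm p v))
    (hE : finrank ℝ E = n + 2 + 2) (hJ : S.IsAlmostHermitian J)
    (hFJ : F = (c₂ - 1) • constCurvature (S.formIm p)
      + ((c₁ - c₂) / 3) • endCurvature (S.formIm p) J)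
    (hx : S.formIm p x x = 1) {T : Module.End ℝ (S.g.BarPerp (S.ξ 0 p + (x : TangentSpace I p)))}
    (hT : S.g.IsJacobiOperator cov (S.ξ 0 p + (x : TangentSpace I p)) T) :
    have : FiniteDimensional ℝ (TangentSpace I p) := inferInstanceAs (FiniteDimensional ℝ E)
    T.charpoly = (X ^ n * ((X - C (c₁ - c₂)) * (X - C (1 - c₂)))).comp (X - C c₂) := by
  intro _
  obtain ⟨hw₁, hw₂, hw⟩ := jacobi_eq_of_almostHermitian S.formIm_symm hJ.1 hJ.2 hFJ hx
  rw [formIm_apply] at hw₁ hw₂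
  have huw : S.g.form p (S.ξ 0 p + x) (J x) = 0 := by
    rw [map_add, add_apply, hw₂, S.g.symm, form_coe_ξ, add_zero]
  have huξ : S.g.form p (S.ξ 0 p + x) (S.ξ 1 p) = 0 := by
    rw [map_add, add_apply, form_coe_ξ, form_ξ, S.η_ξ]
    simp
  have e1 := S.ε_one hξ
  -- Modulo `u`, the operator is `c₂` plus `c₁ - c₂` along `Jx` and `1 - c₂` along `ξ_2`. The class
  -- of `ξ_2` therefore has eigenvalue `1`.
  refine charpoly_of_rank_two_perturbation (l₁ := barForm huw) (l₂ := barForm huξ)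
    (v₁ := S.g.toBar _ ⟨J x, huw⟩) (v₂ := S.g.toBar _ ⟨S.ξ 1 p, huξ⟩) hw₁ ?_ ?_ ?_ ?_
    (finrank_barPerp hE hξ hx)
  · rw [barForm_toBar, S.g.symm, form_coe_ξ]
  · rw [barForm_toBar, form_coe_ξ]
  · rw [barForm_toBar, form_ξ, S.η_ξ, e1]
    simp
  · intro z
    obtain ⟨⟨y, hyu⟩, rfl⟩ := Submodule.mkQ_surjective _ z
    obtain ⟨h, hTy⟩ := hT ⟨y, hyu⟩
    refine hTy.trans ?_
    change _ = c₂ • S.g.toBar _ ⟨y, hyu⟩ + (_ * S.g.form p y (J x)) • S.g.toBar _ _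
      + (_ * S.g.form p y (S.ξ 1 p)) • S.g.toBar _ _
    simp only [← map_smul, ← map_add]
    have hy : S.g.form p y x = S.η 0 p y := by
      have h : S.g.form p (S.ξ 0 p + x) y = 0 := hyu
      rw [map_add, add_apply, form_ξ, S.ε_zero hξ] at h
      rw [S.g.symm]
      linarith
    have hyw : S.formIm p (S.projIm p y) (J x) = S.g.form p y (J x) := by
      rw [formIm_apply, S.g.symm, form_projIm, S.g.symm]
    have hyx : S.formIm p (S.projIm p y) x = S.η 0 p y := by
      rw [formIm_apply, S.g.symm, form_projIm, S.g.symm, hy]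
    -- The term `η̃(y) u` comes from `S^*`. The other one arises because `π^I y - g(y, x) x` is `y -
    -- η^2(y) ξ_2 - η^1(y) u`, as `g(y, x) = η^1(y)` on `u^⊥`.
    refine toBar_eq_of_sub_eq_smul (k := S.ηtilde p y - (c₂ - 1) * S.η 0 p y) ?_
    simp only [Submodule.coe_add, Submodule.coe_smul]
    rw [curvature_null hξ hx hF hyu, hw, hyw, hyx, S.g.symm p y (S.ξ 1 p), form_ξ, e1]
    simp only [Submodule.coe_add, Submodule.coe_sub, Submodule.coe_smul, coe_projIm,
      Fin.sum_univ_two]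
    module

/-- The Osserman condition in terms of the curvature tensor of `Im φ`. -/
lemma conditionA_iff [T2Space M] [Nontrivial E] (hcov : IsLeviCivita S.g cov)
    (hξ : S.g.form p (S.ξ 0 p) (S.ξ 0 p) < 0) (hFalg : IsAlgCurvature (S.formIm p) F)
    (hF : ∀ x y v, curvature cov p x y v
      = S.upperS p x y v + F (S.projIm p x) (S.projIm p y) (S.projIm p v))
    (hn : 1 < n) (hE : finrank ℝ E = 2 * n + 2) (hc : c₁ ≠ c₂) :
    S.ConditionA cov p n c₁ c₂ ↔ ∃ J : Module.End ℝ (S.imφ p), S.IsAlmostHermitian J ∧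
      F = (c₂ - 1) • constCurvature (S.formIm p)
        + ((c₁ - c₂) / 3) • endCurvature (S.formIm p) J := by
  have : FiniteDimensional ℝ (TangentSpace I p) := inferInstanceAs (FiniteDimensional ℝ E)
  have hIm : finrank ℝ (S.imφ p) = 2 * (n - 1) + 2 := by
    rw [finrank_imφ hE]
    omega
  constructor
  -- Only the eigenvalue clause is used: it implies the form of `F`, which in turn yields the
  -- Osserman clause.
  · rintro ⟨-, h⟩
    have : Nontrivial (S.imφ p) := Module.nontrivial_of_finrank_pos (R := ℝ) (by omega)
    obtain ⟨x₀, hx₀⟩ := exists_ne (0 : S.imφ p)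
    obtain ⟨J, hJ₁, hJ₂, hJ⟩ := exists_almostHermitian_of_jacobi S.formIm_symm (S.formIm_pos hξ)
      hFalg (fun h ↦ hc (sub_left_injective h))
        (exists_jacobi_eq hFalg S.formIm_symm (S.formIm_pos hξ) hc
        hIm fun x hx ↦ ((jacobiHasEigenvalues_iff hcov hξ hFalg hF hx).1
          (h _ (exists_null_eq.2 ⟨x, hx, rfl⟩))).2) hx₀
    rw [sub_sub_sub_cancel_right] at hJ
    exact ⟨J, ⟨hJ₁, hJ₂⟩, hJ⟩
  · rintro ⟨J, hJ, hFJ⟩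
    refine ⟨⟨(X ^ (2 * (n - 1)) * ((X - C (c₁ - c₂)) * (X - C (1 - c₂)))).comp (X - C c₂),
      fun u hu ↦ ?_⟩, fun u hu ↦ ?_⟩
    · obtain ⟨x, hx, rfl⟩ := exists_null_eq.1 hu
      obtain ⟨T, hT⟩ := exists_isJacobiOperator hcov (S.ξ 0 p + (x : TangentSpace I p))
      exact ⟨T, hT, charpoly_jacobiOperator (n := 2 * (n - 1)) hξ hF (by omega) hJ hFJ hx hT⟩
    · obtain ⟨x, hx, rfl⟩ := exists_null_eq.1 hu
      rw [jacobiHasEigenvalues_iff hcov hξ hFalg hF hx]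
      obtain ⟨hw₁, hw₂, hw⟩ := jacobi_eq_of_almostHermitian S.formIm_symm hJ.1 hJ.2 hFJ hx
      have hfin := finrank_ker_form (g := S.formIm p) (x := x) (by rw [hx]; exact one_ne_zero)
      -- Here `n > 1` matters: it makes the multiplicity of `c₂` positive, so that `c₂` is an
      -- eigenvalue.
      refine hasEigenvalue_of_rank_one_perturbation (m := 2 * (n - 1))
        (g := (S.formIm p).domRestrict₁₂ (LinearMap.ker (S.formIm p x))
          (LinearMap.ker (S.formIm p x))) (w := ⟨J x, hw₂⟩)
        (fun y z ↦ S.formIm_symm (y : S.imφ p) z) hc (by omega) (by omega) hw₁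
        fun y ↦ Subtype.ext ?_
      have hy : S.formIm p y x = 0 := (S.formIm_symm _ _).trans y.2
      rw [coe_shiftedJacobi, hw, hy]
      simp only [Submodule.coe_add, Submodule.coe_smul, LinearMap.domRestrict₁₂_apply]
      module

/-- The equivalence of the three conditions for fixed eigenvalues. -/
lemma tfae_conditions [T2Space M] [Nontrivial E] (hcov : IsLeviCivita S.g cov)
    (hξ : S.g.form p (S.ξ 0 p) (S.ξ 0 p) < 0)
    (hn : 1 < n) (hE : finrank ℝ E = 2 * n + 2) (hc : c₁ ≠ c₂) :
    [S.ConditionA cov p n c₁ c₂,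
      ∃ J : Module.End ℝ (S.imφ p), S.IsAlmostHermitian J ∧ S.ConditionB cov J c₁ c₂,
      S.ConditionC₁ cov p ∧
        ∃ J : Module.End ℝ (S.imφ p), S.IsAlmostHermitian J ∧
          S.ConditionC₂ cov J c₁ c₂].TFAE := by
  -- With a common `F`, all three conditions become literally the same statement.
  obtain ⟨F, hFalg, hF⟩ := exists_curvature_eq hcov hξ
  simp only [conditionA_iff hcov hξ hFalg hF hn hE hc, conditionB_iff hF, conditionC₂_iff hξ hF,
    conditionC₁ hcov hξ, true_and]
  tfae_finish

end LorentzSStructure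

end PhiNullOsserman

end

theorem theorem5p7 (n : ℕ) (hn : 1 < n)
    {M : Type*} [TopologicalSpace M] [T2Space M] [SecondCountableTopology M] [ConnectedSpace M]
    [ChartedSpace (EuclideanSpace ℝ (Fin (2 * n + 2))) M] [IsManifold (𝓡 (2 * n + 2)) ∞ M]
    (S : LorentzSStructure (𝓡 (2 * n + 2)) M 2)
    (hξ : ∀ q, S.g.form q (S.ξ 0 q) (S.ξ 0 q) < 0)
    (cov : CovariantDerivative (𝓡 (2 * n + 2)) (EuclideanSpace ℝ (Fin (2 * n + 2)))
      (TangentSpace (𝓡 (2 * n + 2)) : M → Type _))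
    (hcov : IsLeviCivita S.g cov) (p : M) :
    [∃ c₁ c₂ : ℝ, c₁ ≠ c₂ ∧ S.ConditionA cov p n c₁ c₂,
      ∃ (J : Module.End ℝ (S.imφ p)) (c₁ c₂ : ℝ), S.IsAlmostHermitian J ∧ c₁ ≠ c₂ ∧
        S.ConditionB cov J c₁ c₂,
      S.ConditionC₁ cov p ∧
        ∃ (J : Module.End ℝ (S.imφ p)) (c₁ c₂ : ℝ), S.IsAlmostHermitian J ∧ c₁ ≠ c₂ ∧
          S.ConditionC₂ cov J c₁ c₂].TFAE ∧
    ∀ c₁ c₂ : ℝ, c₁ ≠ c₂ →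
      [S.ConditionA cov p n c₁ c₂,
        ∃ J : Module.End ℝ (S.imφ p), S.IsAlmostHermitian J ∧ S.ConditionB cov J c₁ c₂,
        S.ConditionC₁ cov p ∧
          ∃ J : Module.End ℝ (S.imφ p), S.IsAlmostHermitian J ∧
            S.ConditionC₂ cov J c₁ c₂].TFAE := by
  have key : ∀ c₁ c₂ : ℝ, c₁ ≠ c₂ →
      [S.ConditionA cov p n c₁ c₂,
        ∃ J : Module.End ℝ (S.imφ p), S.IsAlmostHermitian J ∧ S.ConditionB cov J c₁ c₂,
        S.ConditionC₁ cov p ∧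
          ∃ J : Module.End ℝ (S.imφ p), S.IsAlmostHermitian J ∧
            S.ConditionC₂ cov J c₁ c₂].TFAE := fun c₁ c₂ hc ↦
    LorentzSStructure.tfae_conditions hcov (hξ p) hn (by simp) hc
  refine ⟨?_, key⟩
  tfae_have 1 → 2 := by
    rintro ⟨c₁, c₂, hc, h⟩
    obtain ⟨J, hJ, h'⟩ := ((key c₁ c₂ hc).out 0 1).1 h
    exact ⟨J, c₁, c₂, hJ, hc, h'⟩
  tfae_have 2 → 3 := by
    rintro ⟨J, c₁, c₂, hJ, hc, h⟩
    obtain ⟨h₁, J, hJ, h'⟩ := ((key c₁ c₂ hc).out 1 2 rfl rfl).1 ⟨J, hJ, h⟩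
    exact ⟨h₁, J, c₁, c₂, hJ, hc, h'⟩
  tfae_have 3 → 1 := by
    rintro ⟨h₁, J, c₁, c₂, hJ, hc, h⟩
    exact ⟨c₁, c₂, hc, ((key c₁ c₂ hc).out 2 0 rfl rfl).1 ⟨h₁, J, hJ, h⟩⟩
  tfae_finish
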